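/- Let $\mu$ be a probability measure on $\mathbb{Z}$ that is symmetric ($\mu(-k)=\mu(k)$ for all $k$) and strictly aperiodic (its support is not contained in any coset of a proper subgroup of $\mathbb{Z}$), and let $\theta(t)=\sum_{k\in\mathbb{Z}}\mu(k)e^{2\pi i k t}$, which is real-valued. Let $\mu^n$ denote the $n$-fold convolution power of $\mu$. Suppose that for some $0<\alpha\le 1$ $$\sum_{|k|\le n}k^2\mu(k)=O(n^{1-\alpha})\qquad(n\to\infty),$$ and that for some $\delta>0$ the second derivative $\theta''(t)$ exists and satisfies $\theta''(t)<0$ for $0<|t|<\delta$, and $\theta''(t)=p(t)+O(1)$ as $t\to0$, $t\neq 0$, where $p$ is a real-valued function that is non-decreasing on $(0,\delta)$. Then for every probability space $(X,\mathcal{B},\lambda)$, every invertible measure preserving transformation $T:X\to X$ (with measurable inverse) and every $f\in L^1(\lambda)$, for $\lambda$-almost every $x$ the series $$\mu^n f(x)=\sum_{k\in\mathbb{Z}}\mu^n(k)f(T^kx)$$ converges absolutely for every $n$, and the sequence $(\mu^nf(x))_{n}$ converges to a finite limit. Moreover $\mu$ has bounded angular ratio, that is, $$1\le\sup_{t\in[-1/2,1/2),\,t\ne0}\frac{|\theta(t)-1|}{1-|\theta(t)|}<\infty,$$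 and this quotient equals $1$ for all sufficiently small $t\neq0$. -/

import Mathlib

open Filter Topology MeasureTheory Asymptotics

/-- `μ : ℤ → ℝ`, given by its weights, is a probability measure on `ℤ`. -/
def IsProbabilityOnInt (μ : ℤ → ℝ) : Prop :=
  (∀ k, 0 ≤ μ k) ∧ HasSum μ 1

/-- The measure is symmetric: `μ(-k) = μ(k)`. -/
def IsSymmetricOnInt (μ : ℤ → ℝ) : Prop :=
  ∀ k, μ (-k) = μ k

/-- The support of `μ` is not contained in any coset `a + H` of a proper subgroup `H` of `ℤ`. -/
def StrictlyAperiodic (μ : ℤ → ℝ) : Prop :=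
  ∀ (H : AddSubgroup ℤ) (a : ℤ), H ≠ ⊤ → ¬ (Function.support μ ⊆ {k | k - a ∈ H})

/-- Convolution `(μ * ν)(k) = ∑_j μ(j) ν(k - j)` on `ℤ`. -/
noncomputable def convInt (μ ν : ℤ → ℝ) (k : ℤ) : ℝ :=
  ∑' j : ℤ, μ j * ν (k - j)

/-- The `n`-fold convolution power of `μ`; the zeroth power is the unit mass at `0`. -/
noncomputable def convPow (μ : ℤ → ℝ) : ℕ → ℤ → ℝ
  | 0 => Pi.single 0 1
  | n + 1 => convInt μ (convPow μ n)

/-- The Fourier transform `θ(t) = ∑_k μ(k) e^{2πikt}`. -/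
noncomputable def fourierInt (μ : ℤ → ℝ) (t : ℝ) : ℂ :=
  ∑' k : ℤ, (μ k : ℂ) * Complex.exp (2 * Real.pi * Complex.I * k * t)

/-- The angular ratio `|θ(t) - 1| / (1 - |θ(t)|)`. -/
noncomputable def angularRatio (μ : ℤ → ℝ) (t : ℝ) : ℝ :=
  ‖fourierInt μ t - 1‖ / (1 - ‖fourierInt μ t‖)

/-- `μ` is strictly aperiodic and `1 ≤ sup_{t ≠ 0} |θ(t) - 1| / (1 - |θ(t)|) < ∞`, where `t` ranges
over `[-1/2, 1/2)`. For strictly aperiodic `μ` the denominator does not vanish there. -/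
def BoundedAngularRatio (μ : ℤ → ℝ) : Prop :=
  StrictlyAperiodic μ ∧
    ∃ M : ℝ, 1 ≤ M ∧
      IsLUB (angularRatio μ '' {t | t ∈ Set.Ico (-1 / 2 : ℝ) (1 / 2) ∧ t ≠ 0}) M

/-- The `k`-th term `μⁿ(k) f(T^k x)` of the series that defines `μⁿ f(x)`. -/
noncomputable def convPowTerm {X : Type*} [MeasurableSpace X] (μ : ℤ → ℝ) (T : X ≃ᵐ X)
    (f : X → ℂ) (n : ℕ) (x : X) (k : ℤ) : ℂ :=
  (convPow μ n k : ℂ) * f (((T.toEquiv : Equiv.Perm X) ^ k) x)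

/-- `μⁿ f(x) = ∑_k μⁿ(k) f(T^k x)`. -/
noncomputable def convPowOp {X : Type*} [MeasurableSpace X] (μ : ℤ → ℝ) (T : X ≃ᵐ X)
    (f : X → ℂ) (n : ℕ) (x : X) : ℂ :=
  ∑' k : ℤ, convPowTerm μ T f n x k

/-! Almost everywhere convergence is proved by the Banach principle: a weak type (1,1) maximal
inequality plus convergence on a dense class. The maximal inequality comes from Calderón–Zygmund
theory on `ℤ`, once the kernels `μⁿ` satisfy a Hörmander condition uniformly in `n`: `|μⁿ(x+h) -
μⁿ(x)| ≤ Φ(h,x)` for `|x| > 2|h|`, with `∑ₓ Φ(h,x)` bounded independently of `h`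
(`exists_hormander_majorant`).

To get this condition, write `μⁿ` as the Fourier coefficients of `θⁿ` and split `θⁿ` by a smooth
cutoff `χ` at `0`. Away from `0`, strict aperiodicity gives `|θ| ≤ ρ < 1`; the `ℓ¹` norms of the
Fourier coefficients of `(1-χ)θⁿ` decay like `nρⁿ`, so their sum over `n` is a summable majorant.
Near `0`, put `φ = 1 - θ`. The hypotheses say that `φ'' > 0` decreases up to a bounded error, and
this together with `φ ≥ ct²` yields `tφ'' ≤ Cφ'` and `tφ' ≤ Cφ` (`exists_deriv_comparison`). A unit
translation multiplies the integrand by `e^{-2πit} - 1`, of size `t`. After two integrations by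
parts the only dangerous quantity is `t(χθⁿ)''`, and the comparison bounds it by multiples of `1`,
`nθⁿ⁻¹φ'` and `n(n-1)θⁿ⁻²(1-θ)φ'`. The last two are exact derivatives, of `-θⁿ` and `-(nθⁿ⁻¹ -
(n-1)θⁿ)`, whose increments are bounded independently of `n`. Hence the near part changes by
`O(1/x²)` per unit step, uniformly in `n`.

Transference carries the maximal inequality to the measure preserving system. The dense class
consists of invariant functions plus functions `ψ - A_Nψ`, with `ψ` bounded and `A_N` the ergodic
averages: `μⁿ` fixes the former and sends the latter to `0`, because `‖μⁿ(· + i) - μⁿ‖₁ → 0`. That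
limit follows by dominated convergence, with `Φ` as the majorant and `μⁿ(x) → 0` pointwise.

The angular ratio is simpler: `θ` is real and positive near `0`, so the ratio is `1` there, and
compactness bounds it elsewhere. -/

/-- The cosine transform `∑ μ(k) cos(2πkt)`, the Fourier transform of a symmetric measure. -/
noncomputable def cosTransform (μ : ℤ → ℝ) (t : ℝ) : ℝ :=
  ∑' k : ℤ, μ k * Real.cos (2 * Real.pi * k * t)

/-- The termwise derivative of `cosTransform`. -/
noncomputable def cosTransformDeriv (μ : ℤ → ℝ) (t : ℝ) : ℝ :=
  ∑' k : ℤ, -(μ k * (2 * Real.pi * k) * Real.sin (2 * Real.pi * k * t))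

/-! ### First moment from the truncated second moment -/

/-- Each of the `a` indices `m` in `[a, 2a)` contributes at least `1/4`. This turns a weight `|k|`
into a sum of truncated weights `k² / m²`. -/
theorem le_four_mul_sum_sq_div_sq (a N : ℕ) (haN : a ≤ N) :
    (a : ℝ) ≤ 4 * ∑ m ∈ Finset.range (2 * N + 1),
      if a ≤ m then (a : ℝ) ^ 2 / (m : ℝ) ^ 2 else 0 := by
  rcases Nat.eq_zero_or_pos a with rfl | ha
  · simp only [CharP.cast_eq_zero]
    positivity
  have h1 : ∑ m ∈ Finset.Ico a (2 * a), (1 / 4 : ℝ) ≤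
      ∑ m ∈ Finset.range (2 * N + 1), if a ≤ m then (a : ℝ) ^ 2 / (m : ℝ) ^ 2 else 0 := by
    refine le_trans (Finset.sum_le_sum (g := fun m : ℕ =>
      if a ≤ m then (a : ℝ) ^ 2 / (m : ℝ) ^ 2 else 0) ?_)
      (Finset.sum_le_sum_of_subset_of_nonneg ?_ ?_)
    · intro m hm
      rw [Finset.mem_Ico] at hm
      have ha' : (0 : ℝ) < a := by exact_mod_cast ha
      have h2 : (a : ℝ) ≤ m := by exact_mod_cast hm.1
      have h3 : (m : ℝ) ≤ 2 * a := by exact_mod_cast hm.2.le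
      have hm0 : (0 : ℝ) < m := by linarith
      simp only [hm.1, if_true]
      rw [div_le_div_iff₀ (by norm_num) (by positivity)]
      nlinarith
    · intro m hm
      simp only [Finset.mem_Ico, Finset.mem_range] at hm ⊢
      omega
    · intro m _ _
      positivity
  rw [Finset.sum_const, Nat.card_Ico, nsmul_eq_mul] at h1
  have : ((2 * a - a : ℕ) : ℝ) = a := by
    congr 1; omega
  rw [this] at h1
  linarith

/-- Exchanging sums gives `∑ |k| μ(k) ≤ 4 ∑ₘ m⁻² ∑_{|k| ≤ m} k² μ(k)`, and the terms on the right
are `O(m^{-1-α})`. -/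
theorem summable_abs_mul_of_truncated_second_moment {μ : ℤ → ℝ} (hμ : ∀ k, 0 ≤ μ k)
    {α : ℝ} (hα : 0 < α)
    (h : (fun n : ℕ => ∑ k ∈ Finset.Icc (-(n : ℤ)) (n : ℤ), (k : ℝ) ^ 2 * μ k)
      =O[atTop] (fun n : ℕ => (n : ℝ) ^ (1 - α))) :
    Summable fun k : ℤ => |(k : ℝ)| * μ k := by
  set S : ℕ → ℝ := fun n => ∑ k ∈ Finset.Icc (-(n : ℤ)) (n : ℤ), (k : ℝ) ^ 2 * μ k with hS
  have hS0 : ∀ n, 0 ≤ S n := fun n => Finset.sum_nonneg fun k _ => mul_nonneg (sq_nonneg _) (hμ k)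
  have hsum : Summable fun m : ℕ => S m / (m : ℝ) ^ 2 := by
    refine summable_of_isBigO_nat (g := fun m : ℕ => (m : ℝ) ^ (-1 - α)) ?_ ?_
    · exact Real.summable_nat_rpow.2 (by linarith)
    · have h2 : (fun m : ℕ => S m / (m : ℝ) ^ 2) =O[atTop]
          (fun m : ℕ => (m : ℝ) ^ (1 - α) * ((m : ℝ) ^ 2)⁻¹) := by
        simp only [div_eq_mul_inv]
        exact h.mul (isBigO_refl _ _)
      refine h2.congr' EventuallyEq.rfl ?_
      filter_upwards [eventually_gt_atTop 0] with m hm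
      have hm' : (0 : ℝ) < m := by exact_mod_cast hm
      rw [← Real.rpow_natCast, ← Real.rpow_neg hm'.le, ← Real.rpow_add hm']
      congr 1
      push_cast
      ring
  refine summable_of_sum_le (c := 4 * ∑' m : ℕ, S m / (m : ℝ) ^ 2)
    (fun k => mul_nonneg (abs_nonneg _) (hμ k)) fun u => ?_
  obtain ⟨N, hN⟩ : ∃ N : ℕ, ∀ k ∈ u, k.natAbs ≤ N :=
    ⟨u.sup Int.natAbs, fun k hk => Finset.le_sup (f := Int.natAbs) hk⟩
  have hkey : ∀ k ∈ u, |(k : ℝ)| * μ k ≤ 4 * ∑ m ∈ Finset.range (2 * N + 1),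
      (if k.natAbs ≤ m then (k : ℝ) ^ 2 * μ k else 0) / (m : ℝ) ^ 2 := by
    intro k hk
    have h1 := mul_le_mul_of_nonneg_right (le_four_mul_sum_sq_div_sq k.natAbs N (hN k hk)) (hμ k)
    have h2 : ((k.natAbs : ℕ) : ℝ) = |(k : ℝ)| := by
      rw [← Int.cast_abs, Int.abs_eq_natAbs]; simp
    rw [h2, sq_abs] at h1
    refine h1.trans (le_of_eq ?_)
    rw [mul_assoc, Finset.sum_mul]
    congr 1
    refine Finset.sum_congr rfl fun m _ => ?_
    split_ifs
    · ring
    · simp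
  calc ∑ k ∈ u, |(k : ℝ)| * μ k
      ≤ ∑ k ∈ u, 4 * ∑ m ∈ Finset.range (2 * N + 1),
        (if k.natAbs ≤ m then (k : ℝ) ^ 2 * μ k else 0) / (m : ℝ) ^ 2 := Finset.sum_le_sum hkey
    _ = 4 * ∑ m ∈ Finset.range (2 * N + 1),
        (∑ k ∈ u, if k.natAbs ≤ m then (k : ℝ) ^ 2 * μ k else 0) / (m : ℝ) ^ 2 := by
      rw [← Finset.mul_sum, Finset.sum_comm]
      simp only [Finset.sum_div]
    _ ≤ 4 * ∑ m ∈ Finset.range (2 * N + 1), S m / (m : ℝ) ^ 2 := by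
      gcongr with m _
      rw [← Finset.sum_filter]
      refine Finset.sum_le_sum_of_subset_of_nonneg ?_
        fun k _ _ => mul_nonneg (sq_nonneg _) (hμ k)
      intro k hk
      rw [Finset.mem_filter] at hk
      rw [Finset.mem_Icc]
      omega
    _ ≤ 4 * ∑' m : ℕ, S m / (m : ℝ) ^ 2 := by
      gcongr
      exact hsum.sum_le_tsum _ fun m _ => div_nonneg (hS0 m) (sq_nonneg _)

/-! ### The transform of a symmetric measure -/

section transform

variable {μ : ℤ → ℝ}

theorem summable_mul_cos (hμ : IsProbabilityOnInt μ) (t : ℝ) :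
    Summable fun k : ℤ => μ k * Real.cos (2 * Real.pi * k * t) := by
  refine Summable.of_norm_bounded hμ.2.summable fun k => ?_
  rw [norm_mul, Real.norm_of_nonneg (hμ.1 k)]
  exact mul_le_of_le_one_right (hμ.1 k) (Real.abs_cos_le_one _)

theorem norm_mul_exp (hμ : IsProbabilityOnInt μ) (k : ℤ) (t : ℝ) :
    ‖(μ k : ℂ) * Complex.exp (2 * Real.pi * Complex.I * k * t)‖ = μ k := by
  have : (2 * Real.pi * Complex.I * k * t : ℂ) = ((2 * Real.pi * k * t : ℝ) : ℂ) * Complex.I := by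
    push_cast; ring
  rw [norm_mul, this, Complex.norm_exp_ofReal_mul_I, mul_one, Complex.norm_real,
    Real.norm_of_nonneg (hμ.1 k)]

theorem summable_mul_exp (hμ : IsProbabilityOnInt μ) (t : ℝ) :
    Summable fun k : ℤ => (μ k : ℂ) * Complex.exp (2 * Real.pi * Complex.I * k * t) := by
  refine Summable.of_norm ?_
  simp only [norm_mul_exp hμ]
  exact hμ.2.summable

theorem fourierInt_eq_cosTransform (hμ : IsProbabilityOnInt μ) (hs : IsSymmetricOnInt μ) (t : ℝ) :
    fourierInt μ t = (cosTransform μ t : ℂ) := by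
  have h1 : ∑' k : ℤ, (μ k : ℂ) * Complex.exp (2 * Real.pi * Complex.I * k * t) =
      ∑' k : ℤ, (μ k : ℂ) * Complex.exp (-(2 * Real.pi * Complex.I * k * t)) := by
    rw [← (Equiv.neg ℤ).tsum_eq]
    refine tsum_congr fun k => ?_
    rw [Equiv.neg_apply, hs k]
    push_cast
    congr 2
    ring
  have hsum2 : Summable fun k : ℤ =>
      (μ k : ℂ) * Complex.exp (-(2 * Real.pi * Complex.I * k * t)) := by
    refine (summable_mul_exp hμ (-t)).congr fun k => ?_
    push_cast
    congr 2
    ring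
  have h2 : fourierInt μ t + fourierInt μ t = 2 * (cosTransform μ t : ℂ) := by
    unfold fourierInt
    nth_rewrite 2 [h1]
    rw [← (summable_mul_exp hμ t).tsum_add hsum2, cosTransform, Complex.ofReal_tsum, ← tsum_mul_left]
    refine tsum_congr fun k => ?_
    push_cast
    rw [Complex.cos]
    have e1 : (2 * Real.pi * k * t : ℂ) * Complex.I = 2 * Real.pi * Complex.I * k * t := by ring
    have e2 : -(2 * Real.pi * k * t : ℂ) * Complex.I = -(2 * Real.pi * Complex.I * k * t) := by ring
    rw [e1, e2]
    ring
  linear_combination h2 / 2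

theorem abs_cosTransform_le_one (hμ : IsProbabilityOnInt μ) (t : ℝ) : |cosTransform μ t| ≤ 1 := by
  rw [← hμ.2.tsum_eq, ← Real.norm_eq_abs]
  refine tsum_of_norm_bounded hμ.2.summable.hasSum fun k => ?_
  rw [norm_mul, Real.norm_of_nonneg (hμ.1 k)]
  exact mul_le_of_le_one_right (hμ.1 k) (Real.abs_cos_le_one _)

theorem cosTransform_zero (hμ : IsProbabilityOnInt μ) : cosTransform μ 0 = 1 := by
  simp [cosTransform, hμ.2.tsum_eq]

theorem cosTransform_neg (t : ℝ) : cosTransform μ (-t) = cosTransform μ t := by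
  refine tsum_congr fun k => ?_
  rw [mul_neg, Real.cos_neg]

theorem continuous_cosTransform (hμ : IsProbabilityOnInt μ) : Continuous (cosTransform μ) := by
  refine continuous_tsum (u := μ) (fun k => by fun_prop) hμ.2.summable fun k t => ?_
  rw [norm_mul, Real.norm_of_nonneg (hμ.1 k)]
  exact mul_le_of_le_one_right (hμ.1 k) (Real.abs_cos_le_one _)

theorem norm_deriv_term_le (hμ : IsProbabilityOnInt μ) (k : ℤ) (t : ℝ) :
    ‖-(μ k * (2 * Real.pi * k) * Real.sin (2 * Real.pi * k * t))‖ ≤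
      2 * Real.pi * (|(k : ℝ)| * μ k) := by
  rw [norm_neg, norm_mul, norm_mul, norm_mul, norm_mul, Real.norm_of_nonneg (hμ.1 k),
    Real.norm_of_nonneg Real.pi_pos.le, Real.norm_ofNat, Real.norm_eq_abs, Real.norm_eq_abs]
  have h1 := Real.abs_sin_le_one (2 * Real.pi * k * t)
  have h2 : 0 ≤ μ k * (2 * Real.pi * |(k : ℝ)|) :=
    mul_nonneg (hμ.1 k) (by positivity)
  nlinarith

/-- The first moment dominates the differentiated series, so `θ` is `C¹` across `0` even though
`θ''` may be singular there. -/
theorem hasDerivAt_cosTransform (hμ : IsProbabilityOnInt μ)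
    (h1 : Summable fun k : ℤ => |(k : ℝ)| * μ k) (t : ℝ) :
    HasDerivAt (cosTransform μ) (cosTransformDeriv μ t) t := by
  have hterm : ∀ (k : ℤ) (y : ℝ), HasDerivAt (fun t => μ k * Real.cos (2 * Real.pi * k * t))
      (-(μ k * (2 * Real.pi * k) * Real.sin (2 * Real.pi * k * y))) y := by
    intro k y
    refine (((hasDerivAt_id' y).const_mul (2 * Real.pi * k)).cos.const_mul (μ k)).congr_deriv ?_
    ring
  exact hasDerivAt_tsum (h1.mul_left (2 * Real.pi)) hterm
    (fun k y => norm_deriv_term_le hμ k y) (summable_mul_cos hμ 0) t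

theorem continuous_cosTransformDeriv (hμ : IsProbabilityOnInt μ)
    (h1 : Summable fun k : ℤ => |(k : ℝ)| * μ k) : Continuous (cosTransformDeriv μ) :=
  continuous_tsum (fun k => by fun_prop) (h1.mul_left (2 * Real.pi))
    fun k y => norm_deriv_term_le hμ k y

theorem cosTransformDeriv_zero : cosTransformDeriv μ 0 = 0 := by
  simp [cosTransformDeriv]

/-- If `θ(t) = s = ±1`, then `cos(2πkt) = s` on the whole support, so any two support points `k`,
`a` satisfy `(k - a)t ∈ ℤ`. The support then lies in a coset of `{k | kt ∈ ℤ}`, which is proper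
because `t` is not an integer. -/
theorem abs_cosTransform_lt_one (hμ : IsProbabilityOnInt μ) (hap : StrictlyAperiodic μ)
    {t : ℝ} (ht : ∀ m : ℤ, t ≠ m) : |cosTransform μ t| < 1 := by
  refine lt_of_le_of_ne (abs_cosTransform_le_one hμ t) fun habs => ?_
  obtain ⟨s, hs, hst⟩ : ∃ s : ℝ, (s = 1 ∨ s = -1) ∧ cosTransform μ t = s :=
    ⟨cosTransform μ t, eq_or_eq_neg_of_abs_eq habs, rfl⟩
  have hs2 : s * s = 1 := by rcases hs with rfl | rfl <;> norm_num
  have hsum : HasSum (fun k : ℤ => μ k * (1 - s * Real.cos (2 * Real.pi * k * t))) 0 := by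
    have h1 := hμ.2.sub ((summable_mul_cos hμ t).hasSum.mul_left s)
    rw [show ∑' k : ℤ, μ k * Real.cos (2 * Real.pi * k * t) = s from hst, hs2, sub_self] at h1
    refine h1.congr_fun fun k => ?_
    ring
  have hnn : ∀ k : ℤ, 0 ≤ μ k * (1 - s * Real.cos (2 * Real.pi * k * t)) := by
    intro k
    refine mul_nonneg (hμ.1 k) ?_
    have := Real.neg_one_le_cos (2 * Real.pi * k * t)
    have := Real.cos_le_one (2 * Real.pi * k * t)
    rcases hs with rfl | rfl <;> linarith
  have hzero := (hasSum_zero_iff_of_nonneg hnn).1 hsum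
  have hcos : ∀ k : ℤ, μ k ≠ 0 → Real.cos (2 * Real.pi * k * t) = s := by
    intro k hk
    have h2 := congrFun hzero k
    simp only [Pi.zero_apply, mul_eq_zero, hk, false_or] at h2
    linear_combination (-s) * h2 - Real.cos (2 * Real.pi * k * t) * hs2
  let H : AddSubgroup ℤ :=
    { carrier := {k | ∃ m : ℤ, (k : ℝ) * t = m}
      zero_mem' := ⟨0, by simp⟩
      add_mem' := by
        rintro a b ⟨m, hm⟩ ⟨m', hm'⟩
        refine ⟨m + m', ?_⟩
        push_cast
        rw [add_mul, hm, hm']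
      neg_mem' := by
        rintro a ⟨m, hm⟩
        refine ⟨-m, ?_⟩
        push_cast
        rw [neg_mul, hm] }
  have hH : H ≠ ⊤ := by
    intro htop
    have h1 : (1 : ℤ) ∈ H := by rw [htop]; trivial
    obtain ⟨m, hm⟩ := h1
    exact ht m (by simpa using hm)
  obtain ⟨a, ha⟩ : ∃ a : ℤ, μ a ≠ 0 := by
    by_contra hcon
    push Not at hcon
    have h3 : HasSum μ 0 := by
      rw [show μ = fun _ => 0 from funext hcon]
      exact hasSum_zero
    exact zero_ne_one (h3.unique hμ.2)
  refine hap H a hH fun k hk => ?_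
  have hk' := hcos k hk
  have ha' := hcos a ha
  change ∃ m : ℤ, ((k - a : ℤ) : ℝ) * t = m
  have hsin : ∀ k : ℤ, Real.cos (2 * Real.pi * k * t) = s →
      Real.sin (2 * Real.pi * k * t) = 0 := by
    intro k hk
    have := Real.sin_sq_add_cos_sq (2 * Real.pi * k * t)
    rw [hk] at this
    nlinarith
  have hone : Real.cos (2 * Real.pi * k * t - 2 * Real.pi * a * t) = 1 := by
    rw [Real.cos_sub, hk', ha', hsin k hk', hsin a ha', hs2]
    ring
  obtain ⟨m, hm⟩ := (Real.cos_eq_one_iff _).1 hone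
  refine ⟨m, ?_⟩
  have hpi := Real.pi_pos
  push_cast
  have : (2 * Real.pi) * (((k : ℝ) - a) * t - m) = 0 := by linear_combination -hm
  rcases mul_eq_zero.1 this with h | h
  · linarith
  · linarith

/-- `1 - θ` dominates a quadratic near `0`. -/
theorem exists_mul_sq_le_one_sub_cosTransform (hμ : IsProbabilityOnInt μ)
    (hap : StrictlyAperiodic μ) :
    ∃ c > 0, ∃ r > 0, ∀ t : ℝ, |t| ≤ r → c * t ^ 2 ≤ 1 - cosTransform μ t := by
  obtain ⟨k, hk0, hk⟩ : ∃ k : ℤ, k ≠ 0 ∧ μ k ≠ 0 := by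
    by_contra hcon
    push Not at hcon
    refine hap ⊥ 0 (by simp) fun k hk => ?_
    by_contra hne
    exact hk (hcon k (by simpa using hne))
  have hμk : 0 < μ k := lt_of_le_of_ne (hμ.1 k) (Ne.symm hk)
  have hka : (0 : ℝ) < |(k : ℝ)| := by simpa using hk0
  -- A single frequency `k ≠ 0` of positive mass suffices: `cos y ≤ 1 - 2y²/π²` for `|y| ≤ π`, at `y
  -- = 2πkt`; the radius is where `|y|` reaches `π`.
  refine ⟨8 * μ k * (k : ℝ) ^ 2, by positivity, 1 / (2 * |(k : ℝ)|), by positivity, fun t ht => ?_⟩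
  have hx : |2 * Real.pi * k * t| ≤ Real.pi := by
    rw [abs_mul, abs_mul, abs_mul, abs_of_pos Real.pi_pos, abs_two]
    rw [le_div_iff₀ (by positivity)] at ht
    nlinarith [Real.pi_pos]
  have h1 := Real.cos_le_one_sub_mul_cos_sq hx
  have h2 : μ k * (1 - Real.cos (2 * Real.pi * k * t)) ≤ 1 - cosTransform μ t := by
    have hs := hμ.2.sub (summable_mul_cos hμ t).hasSum
    have := le_hasSum hs k fun j _ => by
      have := Real.cos_le_one (2 * Real.pi * j * t)
      have := hμ.1 j
      nlinarith
    calc _ = μ k - μ k * Real.cos (2 * Real.pi * k * t) := by ring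
      _ ≤ _ := this
  refine le_trans ?_ h2
  have h3 : 2 / Real.pi ^ 2 * (2 * Real.pi * k * t) ^ 2 = 8 * (k : ℝ) ^ 2 * t ^ 2 := by
    field_simp
    ring
  rw [h3] at h1
  nlinarith

end transform

/-! ### Convolution powers as Fourier coefficients -/

section convolution

variable {μ ν : ℤ → ℝ}

theorem isProbabilityOnInt_convInt (hμ : IsProbabilityOnInt μ) (hν : IsProbabilityOnInt ν) :
    IsProbabilityOnInt (convInt μ ν) := by
  refine ⟨fun k => tsum_nonneg fun j => mul_nonneg (hμ.1 j) (hν.1 _), ?_⟩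
  have h1 : HasSum (fun p : ℤ × ℤ => μ p.1 * ν p.2) (1 * 1) :=
    hμ.2.mul hν.2 (hμ.2.summable.mul_of_nonneg hν.2.summable hμ.1 hν.1)
  let e : ℤ × ℤ ≃ ℤ × ℤ :=
    { toFun := fun p => (p.2, p.1 - p.2)
      invFun := fun p => (p.1 + p.2, p.1)
      left_inv := fun p => by ext <;> simp
      right_inv := fun p => by ext <;> simp }
  have h2 : HasSum (fun p : ℤ × ℤ => μ p.2 * ν (p.1 - p.2)) (1 * 1) := e.hasSum_iff.2 h1
  rw [mul_one] at h2
  exact h2.prod_fiberwise fun k => (h2.summable.prod_factor k).hasSum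

theorem isProbabilityOnInt_convPow (hμ : IsProbabilityOnInt μ) (n : ℕ) :
    IsProbabilityOnInt (convPow μ n) := by
  induction n with
  | zero =>
    refine ⟨fun k => ?_, hasSum_pi_single 0 1⟩
    rw [convPow]
    by_cases h : k = 0
    · subst h; simp
    · simp [h]
  | succ n ih => exact isProbabilityOnInt_convInt hμ ih

theorem convPow_le_one (hμ : IsProbabilityOnInt μ) (n : ℕ) (k : ℤ) : convPow μ n k ≤ 1 :=
  le_hasSum (isProbabilityOnInt_convPow hμ n).2 k
    fun j _ => (isProbabilityOnInt_convPow hμ n).1 j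

theorem integral_exp_int (x : ℤ) :
    ∫ t in (-1 / 2 : ℝ)..(1 / 2), Complex.exp (-(2 * Real.pi * Complex.I * x * t)) =
      if x = 0 then 1 else 0 := by
  split_ifs with hx
  · simp [hx]; norm_num
  · have hc : (-(2 * Real.pi * Complex.I * x) : ℂ) ≠ 0 := by
      have := Complex.two_pi_I_ne_zero
      exact neg_ne_zero.2 (mul_ne_zero this (by exact_mod_cast hx))
    have h := integral_exp_mul_complex (a := -1 / 2) (b := 1 / 2) hc
    have h2 : ∀ t : ℝ, (-(2 * Real.pi * Complex.I * x * t) : ℂ) =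
      -(2 * Real.pi * Complex.I * x) * t := fun t => by ring
    simp only [h2]
    rw [h]
    have h3 : (-(2 * Real.pi * Complex.I * x) : ℂ) * ((-1 / 2 : ℝ) : ℂ) =
      -(2 * Real.pi * Complex.I * x) * ((1 / 2 : ℝ) : ℂ) + x * (2 * Real.pi * Complex.I) := by
      push_cast; ring
    rw [h3, Complex.exp_add, Complex.exp_int_mul_two_pi_mul_I]
    simp

theorem continuous_fourierInt (hμ : IsProbabilityOnInt μ) : Continuous (fourierInt μ) :=
  continuous_tsum (u := μ) (fun k => by fun_prop) hμ.2.summable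
    fun k t => (norm_mul_exp hμ k t).le

theorem norm_fourierInt_le_one (hμ : IsProbabilityOnInt μ) (t : ℝ) : ‖fourierInt μ t‖ ≤ 1 := by
  rw [← hμ.2.tsum_eq]
  exact tsum_of_norm_bounded hμ.2.summable.hasSum fun k => (norm_mul_exp hμ k t).le

theorem norm_exp_neg_two_pi (x : ℤ) (t : ℝ) :
    ‖Complex.exp (-(2 * Real.pi * Complex.I * x * t))‖ = 1 := by
  have : (-(2 * Real.pi * Complex.I * x * t) : ℂ) =
      ((-(2 * Real.pi * x * t) : ℝ) : ℂ) * Complex.I := by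
    push_cast; ring
  rw [this, Complex.norm_exp_ofReal_mul_I]

/-- Convolution powers are the Fourier coefficients of the powers of the transform. -/
theorem convPow_eq_integral (hμ : IsProbabilityOnInt μ) (n : ℕ) (x : ℤ) :
    (convPow μ n x : ℂ) = ∫ t in (-1 / 2 : ℝ)..(1 / 2),
      fourierInt μ t ^ n * Complex.exp (-(2 * Real.pi * Complex.I * x * t)) := by
  induction n generalizing x with
  | zero =>
    simp only [pow_zero, one_mul]
    rw [integral_exp_int, convPow, Pi.single_apply]
    split_ifs <;> simp
  | succ n ih =>
    have hF := continuous_fourierInt hμ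
    -- Expand one factor `θ` as its series and integrate termwise; the `j`-th term shifts the
    -- frequency from `x` to `x - j`, matching the convolution.
    have hmain := intervalIntegral.hasSum_integral_of_dominated_convergence
      (μ := volume) (a := -1 / 2) (b := 1 / 2)
      (F := fun j : ℤ => fun t : ℝ => (μ j : ℂ) * Complex.exp (2 * Real.pi * Complex.I * j * t) *
        (fourierInt μ t ^ n * Complex.exp (-(2 * Real.pi * Complex.I * x * t))))
      (bound := fun j _ => μ j)
      (fun j => by
        refine Continuous.aestronglyMeasurable ?_
        fun_prop)
      (fun j => Eventually.of_forall fun t _ => by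
        rw [norm_mul, norm_mul_exp hμ, norm_mul, norm_pow, norm_exp_neg_two_pi, mul_one]
        exact mul_le_of_le_one_right (hμ.1 j)
          (pow_le_one₀ (norm_nonneg _) (norm_fourierInt_le_one hμ t)))
      (Eventually.of_forall fun t _ => hμ.2.summable)
      intervalIntegrable_const
      (f := fun t => fourierInt μ t ^ (n + 1) *
        Complex.exp (-(2 * Real.pi * Complex.I * x * t)))
      (Eventually.of_forall fun t _ => by
        have := (summable_mul_exp hμ t).hasSum.mul_right
          (fourierInt μ t ^ n * Complex.exp (-(2 * Real.pi * Complex.I * x * t)))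
        have he : fourierInt μ t ^ (n + 1) *
              Complex.exp (-(2 * Real.pi * Complex.I * x * t)) = fourierInt μ t *
            (fourierInt μ t ^ n * Complex.exp (-(2 * Real.pi * Complex.I * x * t))) := by
          ring
        rw [he]
        exact this)
    rw [← hmain.tsum_eq, convPow, convInt, Complex.ofReal_tsum]
    refine tsum_congr fun j => ?_
    rw [Complex.ofReal_mul, ih (x - j), ← intervalIntegral.integral_const_mul]
    refine intervalIntegral.integral_congr fun t _ => ?_
    have he : Complex.exp (-(2 * Real.pi * Complex.I * (x - j : ℤ) * t)) =
        Complex.exp (2 * Real.pi * Complex.I * j * t) *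
          Complex.exp (-(2 * Real.pi * Complex.I * x * t)) := by
      rw [← Complex.exp_add]
      congr 1
      push_cast
      ring
    simp only [he]
    ring

end convolution

/-! ### Estimates near the singularity at the origin -/

/-- Comparison of the derivatives of `φ` when `φ''` is positive and decreasing up to a constant. -/
theorem exists_deriv_comparison {φ Q q : ℝ → ℝ} {b c D : ℝ} (hc : 0 < c) (hD : 0 ≤ D)
    (hφ : ∀ t, HasDerivAt φ (Q t) t) (hQ : Continuous Q) (hQ0 : Q 0 = 0) (hφ0 : φ 0 = 0)
    (hq : ∀ t, 0 < t → t < b → HasDerivAt Q (q t) t) (hq0 : ∀ t, 0 < t → t < b → 0 < q t)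
    (hanti : ∀ s t, 0 < s → s < t → t < b → q t ≤ q s + D)
    (hlow : ∀ t, 0 < t → t < b → c * t ^ 2 ≤ φ t) :
    ∃ C, 0 ≤ C ∧ ∀ t, 0 < t → t < b →
      0 ≤ Q t ∧ t * q t ≤ C * Q t ∧ t * Q t ≤ C * φ t := by
  have hφc : Continuous φ := continuous_iff_continuousAt.2 fun t => (hφ t).continuousAt
  have hmvQ : ∀ s t, 0 ≤ s → s < t → t < b → ∃ ξ ∈ Set.Ioo s t, Q t - Q s = q ξ * (t - s) := by
    intro s t hs hst ht
    obtain ⟨ξ, hξ, h⟩ := exists_hasDerivAt_eq_slope Q q hst hQ.continuousOn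
      fun x hx => hq x (hs.trans_lt hx.1) (hx.2.trans ht)
    refine ⟨ξ, hξ, ?_⟩
    rw [h, div_mul_cancel₀]
    linarith
  have hmvφ : ∀ s t, s < t → ∃ ξ ∈ Set.Ioo s t, φ t - φ s = Q ξ * (t - s) := by
    intro s t hst
    obtain ⟨ξ, hξ, h⟩ := exists_hasDerivAt_eq_slope φ Q hst hφc.continuousOn fun x _ => hφ x
    refine ⟨ξ, hξ, ?_⟩
    rw [h, div_mul_cancel₀]
    linarith
  have hmono : ∀ s t, 0 ≤ s → s ≤ t → t < b → Q s ≤ Q t := by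
    intro s t hs hst ht
    rcases hst.eq_or_lt with rfl | hlt
    · exact le_rfl
    · obtain ⟨ξ, hξ, h⟩ := hmvQ s t hs hlt ht
      have := hq0 ξ (hs.trans_lt hξ.1) (hξ.2.trans ht)
      nlinarith
  have hQnn : ∀ t, 0 ≤ t → t < b → 0 ≤ Q t := fun t h0 h1 => by
    simpa [hQ0] using hmono 0 t le_rfl h0 h1
  have hA : ∀ t, 0 < t → t < b → φ t ≤ t * Q t := by
    intro t h0 h1
    obtain ⟨ξ, hξ, h⟩ := hmvφ 0 t h0
    have := hmono ξ t hξ.1.le hξ.2.le h1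
    nlinarith
  have hB : ∀ t, 0 < t → t < b → t * q t ≤ Q t + D * t := by
    intro t h0 h1
    obtain ⟨ξ, hξ, h⟩ := hmvQ 0 t le_rfl h0 h1
    have := hanti ξ t hξ.1 hξ.2 h1
    nlinarith
  -- Doubling: the slope of `Q` on `[t/2, t]` exceeds that on `[0, t/2]` by at most `D`, so `Q t ≤ 2
  -- Q(t/2) + Dt/2`; and `(t/2) Q(t/2) ≤ φ t` since `Q` increases.
  have hC : ∀ t, 0 < t → t < b → t * Q t ≤ 4 * φ t + D * t ^ 2 := by
    intro t h0 h1
    obtain ⟨ξ1, hξ1, e1⟩ := hmvQ (t / 2) t (by linarith) (by linarith) h1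
    obtain ⟨ξ2, hξ2, e2⟩ := hmvQ 0 (t / 2) le_rfl (by linarith) (by linarith)
    obtain ⟨ξ3, hξ3, e3⟩ := hmvφ (t / 2) t (by linarith)
    have k1 := hanti ξ2 ξ1 hξ2.1 (hξ2.2.trans hξ1.1) (hξ1.2.trans h1)
    have k2 := hmono (t / 2) ξ3 (by linarith) hξ3.1.le (hξ3.2.trans h1)
    have k3 : 0 ≤ φ (t / 2) := by
      have := hlow (t / 2) (by linarith) (by linarith)
      have : 0 ≤ c * (t / 2) ^ 2 := by positivity
      linarith
    rw [hQ0] at e2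
    have k4 : Q t ≤ 2 * Q (t / 2) + D * (t / 2) := by nlinarith
    have k5 : (t / 2) * Q (t / 2) ≤ φ t := by nlinarith
    have k6 : t * Q t ≤ t * (2 * Q (t / 2) + D * (t / 2)) := by gcongr
    have k7 : 0 ≤ D * t ^ 2 := by positivity
    nlinarith
  -- The errors `Dt` and `Dt²` are absorbed using `ct² ≤ φ ≤ tQ`.
  refine ⟨4 + D / c, by positivity, fun t h0 h1 => ⟨hQnn t h0.le h1, ?_, ?_⟩⟩
  · have h2 := hlow t h0 h1
    have h3 := hA t h0 h1
    have h4 : c * t ≤ Q t := by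
      have : t * (c * t) ≤ t * Q t := by nlinarith
      exact le_of_mul_le_mul_left this h0
    have h5 : D * t ≤ D / c * Q t := by
      rw [div_mul_eq_mul_div, le_div_iff₀ hc]
      nlinarith
    have := hB t h0 h1
    have := hQnn t h0.le h1
    linarith
  · have h2 := hlow t h0 h1
    have h5 : D * t ^ 2 ≤ D / c * φ t := by
      rw [div_mul_eq_mul_div, le_div_iff₀ hc]
      nlinarith
    have := hC t h0 h1
    linarith

/-- Two integrations by parts for an oscillatory integral, with boundary terms at `0`. -/
theorem norm_integral_mul_exp_le {G G' G'' : ℝ → ℂ} {W W' : ℝ → ℝ} {a : ℝ} (ha : 0 < a)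
    (hG : ContinuousOn G (Set.Icc 0 a)) (hG' : ContinuousOn G' (Set.Icc 0 a))
    (hW : ContinuousOn W (Set.Icc 0 a))
    (dG : ∀ t ∈ Set.Ioo 0 a, HasDerivAt G (G' t) t)
    (dG' : ∀ t ∈ Set.Ioo 0 a, HasDerivAt G' (G'' t) t)
    (dW : ∀ t ∈ Set.Ioo 0 a, HasDerivAt W (W' t) t)
    (hle : ∀ t ∈ Set.Ioo 0 a, ‖G'' t‖ ≤ W' t)
    (hG0 : G 0 = 0) (hGa : G a = 0) (hGa' : G' a = 0) {x : ℤ} (hx : x ≠ 0) :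
    ‖∫ t in (0 : ℝ)..a, G t * Complex.exp (-(2 * Real.pi * Complex.I * x * t))‖ ≤
      (‖G' 0‖ + (W a - W 0)) / (x : ℝ) ^ 2 := by
  set z : ℂ := -(2 * Real.pi * Complex.I * x) with hz
  have hz0 : z ≠ 0 := neg_ne_zero.2 (mul_ne_zero Complex.two_pi_I_ne_zero (by exact_mod_cast hx))
  have huIcc : Set.uIcc 0 a = Set.Icc 0 a := Set.uIcc_of_le ha.le
  have hmin : Set.Ioo (min 0 a) (max 0 a) = Set.Ioo 0 a := by
    rw [min_eq_left ha.le, max_eq_right ha.le]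
  have hexp : ∀ t : ℝ, Complex.exp (-(2 * Real.pi * Complex.I * x * t)) = Complex.exp (z * t) := by
    intro t; congr 1; rw [hz]; ring
  have hder : ∀ t : ℝ, HasDerivAt (fun t : ℝ => Complex.exp (z * t) / z) (Complex.exp (z * t)) t := by
    intro t
    have h1 : HasDerivAt (fun t : ℝ => z * (t : ℂ)) z t := by
      simpa using (Complex.ofRealCLM.hasDerivAt (x := t)).const_mul z
    refine (h1.cexp.div_const z).congr_deriv ?_
    field_simp
  have hnormexp : ∀ t : ℝ, ‖Complex.exp (z * t)‖ = 1 := fun t => by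
    rw [← hexp, norm_exp_neg_two_pi]
  have hcexp : Continuous fun t : ℝ => Complex.exp (z * t) := by fun_prop
  have hcexp' : Continuous fun t : ℝ => Complex.exp (z * t) / z := by fun_prop
  -- No bound on `G''` near `0` is available. Integrability comes from `W'` being the nonnegative
  -- derivative of a function continuous on the closed interval.
  have hWint : IntegrableOn W' (Set.Ioc 0 a) :=
    intervalIntegral.integrableOn_deriv_of_nonneg hW dW fun t ht => (norm_nonneg _).trans (hle t ht)
  have hG''int : IntegrableOn G'' (Set.Ioc 0 a) := by
    rw [integrableOn_Ioc_iff_integrableOn_Ioo] at hWint ⊢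
    refine Integrable.mono' hWint ?_ ?_
    · refine ((measurable_deriv G').aestronglyMeasurable).congr ?_
      filter_upwards [ae_restrict_mem measurableSet_Ioo] with t ht
      exact (dG' t ht).deriv
    · filter_upwards [ae_restrict_mem measurableSet_Ioo] with t ht
      exact hle t ht
  have hG''ii : IntervalIntegrable G'' volume 0 a :=
    (intervalIntegrable_iff_integrableOn_Ioc_of_le ha.le).2 hG''int
  have hW'ii : IntervalIntegrable W' volume 0 a :=
    (intervalIntegrable_iff_integrableOn_Ioc_of_le ha.le).2 hWint
  have hG'ii : IntervalIntegrable G' volume 0 a :=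
    ContinuousOn.intervalIntegrable (by rwa [huIcc])
  have hFTC : ∫ t in (0 : ℝ)..a, W' t = W a - W 0 :=
    intervalIntegral.integral_eq_sub_of_hasDerivAt_of_le ha.le hW dW hW'ii
  have s1 := intervalIntegral.integral_mul_deriv_eq_deriv_mul_of_hasDerivAt (a := 0) (b := a)
    (u := G) (v := fun t : ℝ => Complex.exp (z * t) / z) (u' := G')
    (v' := fun t : ℝ => Complex.exp (z * t))
    (by rwa [huIcc]) hcexp'.continuousOn
    (by rw [hmin]; exact dG) (fun t _ => hder t) hG'ii (hcexp.intervalIntegrable _ _)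
  have s2 := intervalIntegral.integral_mul_deriv_eq_deriv_mul_of_hasDerivAt (a := 0) (b := a)
    (u := G') (v := fun t : ℝ => Complex.exp (z * t) / z) (u' := G'')
    (v' := fun t : ℝ => Complex.exp (z * t))
    (by rwa [huIcc]) hcexp'.continuousOn
    (by rw [hmin]; exact dG') (fun t _ => hder t) hG''ii (hcexp.intervalIntegrable _ _)
  have e1 : ∀ F : ℝ → ℂ, ∫ t in (0 : ℝ)..a, F t * (Complex.exp (z * t) / z) =
      (∫ t in (0 : ℝ)..a, F t * Complex.exp (z * t)) / z := by
    intro F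
    rw [← intervalIntegral.integral_div]
    refine intervalIntegral.integral_congr fun t _ => ?_
    simp only [mul_div_assoc]
  rw [e1] at s1 s2
  simp only [hG0, hGa, hGa', Complex.ofReal_zero, mul_zero, Complex.exp_zero, zero_mul,
    sub_zero, zero_sub] at s1 s2
  have hbound : ‖∫ t in (0 : ℝ)..a, G'' t * Complex.exp (z * t)‖ ≤ W a - W 0 := by
    rw [← hFTC]
    refine intervalIntegral.norm_integral_le_of_norm_le ha.le ?_ hW'ii
    have hne : ∀ᵐ t : ℝ, t ≠ a := by
      rw [ae_iff]; simp
    filter_upwards [hne] with t hta ht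
    rw [norm_mul, hnormexp, mul_one]
    exact hle t ⟨ht.1, lt_of_le_of_ne ht.2 hta⟩
  simp only [hexp]
  rw [s1, s2]
  -- Two integrations by parts produce `1/|z|²`, and `|z| = 2π|x| ≥ |x|`.
  have hznorm : (1 : ℝ) ≤ ‖z‖ ^ 2 / (x : ℝ) ^ 2 ∧ 0 < ‖z‖ := by
    refine ⟨?_, norm_pos_iff.2 hz0⟩
    have hx' : (0 : ℝ) < (x : ℝ) ^ 2 := by positivity
    have : ‖z‖ ^ 2 = (2 * Real.pi) ^ 2 * (x : ℝ) ^ 2 := by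
      rw [hz]
      simp only [norm_neg, norm_mul, Complex.norm_I, mul_one, Complex.norm_ofNat,
        Complex.norm_real, Complex.norm_intCast, mul_pow, sq_abs, Real.norm_eq_abs]
    rw [this, mul_div_assoc, div_self hx'.ne', mul_one]
    nlinarith [Real.pi_gt_three]
  have hx' : (0 : ℝ) < (x : ℝ) ^ 2 := by positivity
  have hnum : 0 ≤ ‖G' 0‖ + (W a - W 0) := add_nonneg (norm_nonneg _) ((norm_nonneg _).trans hbound)
  calc _ = ‖G' 0 + ∫ t in (0 : ℝ)..a, G'' t * Complex.exp (z * t)‖ / ‖z‖ ^ 2 := by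
        rw [norm_neg, norm_div, ← norm_pow]
        rw [show ‖z ^ 2‖ = ‖z‖ * ‖z‖ by rw [norm_pow, sq], ← div_div]
        congr 1
        rw [← norm_div, ← norm_neg]
        congr 1
        ring
    _ ≤ (‖G' 0‖ + (W a - W 0)) / ‖z‖ ^ 2 := by
        gcongr
        exact (norm_add_le _ _).trans (by gcongr)
    _ ≤ (‖G' 0‖ + (W a - W 0)) / (x : ℝ) ^ 2 := by
        refine div_le_div_of_nonneg_left hnum hx' ?_
        have := hznorm.1
        rwa [le_div_iff₀ hx', one_mul] at this

theorem norm_exp_sub_one_le_mul (t : ℝ) :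
    ‖Complex.exp (-(2 * Real.pi * Complex.I * t)) - 1‖ ≤ 2 * Real.pi * |t| := by
  have h := Real.norm_exp_I_mul_ofReal_sub_one_le (x := -(2 * Real.pi * t))
  have e : Complex.I * ((-(2 * Real.pi * t) : ℝ) : ℂ) = -(2 * Real.pi * Complex.I * t) := by
    push_cast; ring
  rw [e] at h
  refine h.trans_eq ?_
  rw [Real.norm_eq_abs, abs_neg, abs_mul, abs_of_pos Real.two_pi_pos]

/-- The second derivative of `χ u^{m+2}` times `t` is controlled by exact derivatives. -/
theorem cutoff_power_second_deriv_bound {K C t u Q q χ χ' χ'' : ℝ} (m : ℕ)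
    (h0 : |χ| ≤ K) (h1 : |χ'| ≤ K) (h2 : |χ''| ≤ K) (ht0 : 0 ≤ t) (ht1 : t ≤ 1)
    (hu0 : 0 ≤ u) (hu1 : u ≤ 1) (hQ : 0 ≤ Q) (hq : 0 ≤ q) (hqQ : t * q ≤ C * Q)
    (hQu : t * Q ≤ C * (1 - u)) :
    t * |χ'' * u ^ (m + 2) + 2 * (χ' * ((m + 2) * u ^ (m + 1) * -Q)) +
      χ * ((m + 2) * (m + 1) * u ^ m * Q ^ 2 - (m + 2) * u ^ (m + 1) * q)| ≤
    K * (1 + (2 + C) * ((m + 2) * u ^ (m + 1) * Q) +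
      C * ((m + 2) * (m + 1) * u ^ m * (1 - u) * Q)) := by
  have hK : 0 ≤ K := (abs_nonneg _).trans h0
  have hp0 : 0 ≤ u ^ (m + 2) := by positivity
  have hp1 : u ^ (m + 2) ≤ 1 := pow_le_one₀ hu0 hu1
  set v : ℝ := (m + 2) * u ^ (m + 1) with hv
  set w : ℝ := (m + 2) * (m + 1) * u ^ m with hw
  have hv0 : 0 ≤ v := by positivity
  have hw0 : 0 ≤ w := by positivity
  have b1 : |χ'' * u ^ (m + 2)| ≤ K := by
    rw [abs_mul, abs_of_nonneg hp0]
    calc |χ''| * u ^ (m + 2) ≤ K * 1 := by gcongr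
      _ = K := mul_one K
  have b2 : |2 * (χ' * (v * -Q))| ≤ 2 * (K * (v * Q)) := by
    rw [abs_mul, abs_two, abs_mul, abs_mul, abs_neg, abs_of_nonneg hv0, abs_of_nonneg hQ]
    gcongr
  have b3 : |χ * (w * Q ^ 2 - v * q)| ≤ K * (w * Q ^ 2 + v * q) := by
    rw [abs_mul]
    gcongr
    refine (abs_sub _ _).trans_eq ?_
    rw [abs_of_nonneg (by positivity), abs_of_nonneg (by positivity)]
  have b4 : |χ'' * u ^ (m + 2) + 2 * (χ' * (v * -Q)) + χ * (w * Q ^ 2 - v * q)| ≤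
      K + 2 * (K * (v * Q)) + K * (w * Q ^ 2 + v * q) :=
    (abs_add_three _ _ _).trans (by gcongr)
  calc _ ≤ t * (K + 2 * (K * (v * Q)) + K * (w * Q ^ 2 + v * q)) := by gcongr
    _ = K * (t * (1 + 2 * (v * Q)) + w * Q * (t * Q) + v * (t * q)) := by ring
    -- The factor `t` is spent on one `Q` of the `Q²` term and on `q` in the `q` term; elsewhere `t
    -- ≤ 1` is enough.
    _ ≤ K * (1 * (1 + 2 * (v * Q)) + w * Q * (C * (1 - u)) + v * (C * Q)) := by gcongr
    _ = _ := by ring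

set_option maxHeartbeats 1000000 in
/-- Uniform smoothness of the Fourier integrals of `χ u ^ n` near the singularity at `0`. -/
theorem exists_norm_integral_cutoff_power_le {u Q q χ χ' χ'' : ℝ → ℝ} {a K C : ℝ}
    (ha : 0 < a) (ha1 : a ≤ 1) (hC : 0 ≤ C)
    (hu : ∀ t, HasDerivAt u (-Q t) t) (hQ : Continuous Q)
    (hq : ∀ t ∈ Set.Ioo 0 a, HasDerivAt Q (q t) t)
    (hχ : ∀ t, HasDerivAt χ (χ' t) t) (hχ' : ∀ t, HasDerivAt χ' (χ'' t) t)
    (hK : ∀ t, |χ t| ≤ K ∧ |χ' t| ≤ K ∧ |χ'' t| ≤ K) (hχa : χ a = 0) (hχa' : χ' a = 0)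
    (hu0 : u 0 = 1) (hub : ∀ t ∈ Set.Icc 0 a, 0 ≤ u t ∧ u t ≤ 1)
    (hcmp : ∀ t ∈ Set.Ioo 0 a, 0 ≤ Q t ∧ 0 ≤ q t ∧ t * q t ≤ C * Q t ∧ t * Q t ≤ C * (1 - u t)) :
    ∃ M, 0 ≤ M ∧ ∀ (m : ℕ) (x : ℤ), x ≠ 0 →
      ‖(∫ t in (0 : ℝ)..a, ((χ t * u t ^ (m + 2) : ℝ) : ℂ) *
          Complex.exp (-(2 * Real.pi * Complex.I * (x + 1 : ℤ) * t))) -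
        ∫ t in (0 : ℝ)..a, ((χ t * u t ^ (m + 2) : ℝ) : ℂ) *
          Complex.exp (-(2 * Real.pi * Complex.I * x * t))‖ ≤ M / (x : ℝ) ^ 2 := by
  have hK0 : 0 ≤ K := (abs_nonneg _).trans (hK 0).1
  have hpi3 := Real.pi_gt_three
  have hpi4 := Real.pi_le_four
  -- Chosen to exceed `88K`, `(32 + 8C)K` and `8CK`, the coefficients of `1`, `v` and `w` in the
  -- final bound for `‖G''‖`.
  set L : ℝ := K * (100 + 8 * C) with hL
  have hL0 : 0 ≤ L := by positivity
  have huc : Continuous u := continuous_iff_continuousAt.2 fun t => (hu t).continuousAt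
  have hχc : Continuous χ := continuous_iff_continuousAt.2 fun t => (hχ t).continuousAt
  have hχc' : Continuous χ' := continuous_iff_continuousAt.2 fun t => (hχ' t).continuousAt
  refine ⟨2 * Real.pi * K + 3 * L, by positivity, fun m x hx => ?_⟩
  -- The multiplier of a unit translation; `‖E t‖ ≤ 2πt` supplies the factor `t` that tames `g''`.
  let E : ℝ → ℂ := fun t => Complex.exp (-(2 * Real.pi * Complex.I * t)) - 1
  let e : ℝ → ℂ := fun t => Complex.exp (-(2 * Real.pi * Complex.I * t))
  let g : ℝ → ℝ := fun t => χ t * u t ^ (m + 2)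
  let g' : ℝ → ℝ := fun t => χ' t * u t ^ (m + 2) + χ t * ((m + 2) * u t ^ (m + 1) * -Q t)
  let g'' : ℝ → ℝ := fun t => χ'' t * u t ^ (m + 2) +
    2 * (χ' t * ((m + 2) * u t ^ (m + 1) * -Q t)) +
      χ t * ((m + 2) * (m + 1) * u t ^ m * Q t ^ 2 - (m + 2) * u t ^ (m + 1) * q t)
  -- An explicit primitive of the majorant of `‖G''‖`. Since `u ∈ [0, 1]`, its increment over `[0,
  -- a]` is at most `3L`, whatever `m` is.
  let W : ℝ → ℝ := fun t => L * (t - u t ^ (m + 2) -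
    ((m + 2) * u t ^ (m + 1) - (m + 1) * u t ^ (m + 2)))
  have de : ∀ t, HasDerivAt e (-(2 * Real.pi * Complex.I) * e t) t := by
    intro t
    have h1 : HasDerivAt (fun t : ℝ => -(2 * Real.pi * Complex.I * (t : ℂ)))
        (-(2 * Real.pi * Complex.I)) t := by
      have h0 : HasDerivAt (fun t : ℝ => (t : ℂ)) 1 t := by
        simpa using (hasDerivAt_id' t).ofReal_comp
      exact (h0.const_mul (2 * Real.pi * Complex.I)).fun_neg.congr_deriv (by ring)
    refine h1.cexp.congr_deriv ?_
    simp only [e]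
    ring
  have dE : ∀ t, HasDerivAt E (-(2 * Real.pi * Complex.I) * e t) t := fun t =>
    (de t).sub_const 1
  have ne : ∀ t, ‖e t‖ = 1 := fun t => by
    simpa using norm_exp_neg_two_pi 1 t
  have dpow : ∀ (k : ℕ) (t : ℝ), HasDerivAt (fun t => u t ^ (k + 1))
      ((k + 1) * u t ^ k * -Q t) t := by
    intro k t
    exact ((hu t).fun_pow (k + 1)).congr_deriv (by simp)
  have dg : ∀ t, HasDerivAt g (g' t) t := by
    intro t
    refine ((hχ t).fun_mul (dpow (m + 1) t)).congr_deriv ?_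
    simp only [g']
    push_cast
    ring
  have dg' : ∀ t ∈ Set.Ioo 0 a, HasDerivAt g' (g'' t) t := by
    intro t ht
    refine (((hχ' t).fun_mul (dpow (m + 1) t)).fun_add ((hχ t).fun_mul
      (((dpow m t).const_mul ((m : ℝ) + 2)).fun_mul (hq t ht).fun_neg))).congr_deriv ?_
    simp only [g'']
    push_cast
    ring
  have hg'c : Continuous g' := by fun_prop
  have hgc : Continuous g := by fun_prop
  have hec : Continuous e := by fun_prop
  have hEc : Continuous E := by fun_prop
  have key := norm_integral_mul_exp_le (G := fun t => (g t : ℂ) * E t)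
    (G' := fun t => (g' t : ℂ) * E t + (g t : ℂ) * (-(2 * Real.pi * Complex.I) * e t))
    (G'' := fun t => (g'' t : ℂ) * E t + 2 * ((g' t : ℂ) * (-(2 * Real.pi * Complex.I) * e t)) +
      (g t : ℂ) * (-(2 * Real.pi * Complex.I) * (-(2 * Real.pi * Complex.I) * e t)))
    (W := W)
    (W' := fun t => L * (1 + (m + 2) * u t ^ (m + 1) * Q t +
      (m + 2) * (m + 1) * u t ^ m * (1 - u t) * Q t)) ha
    (by fun_prop) (by fun_prop) (by fun_prop)
    (fun t _ => (dg t).ofReal_comp.fun_mul (dE t))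
    (fun t ht => by
      refine (((dg' t ht).ofReal_comp.fun_mul (dE t)).fun_add
        ((dg t).ofReal_comp.fun_mul ((de t).const_mul _))).congr_deriv ?_
      ring)
    (fun t _ => by
      refine ((((hasDerivAt_id' t).fun_sub (dpow (m + 1) t)).fun_sub
        (((dpow m t).const_mul ((m : ℝ) + 2)).fun_sub
          ((dpow (m + 1) t).const_mul ((m : ℝ) + 1)))).const_mul L).congr_deriv ?_
      push_cast
      ring)
    (fun t ht => by
      obtain ⟨c1, c2, c3, c4⟩ := hcmp t ht
      obtain ⟨k0, k1, k2⟩ := hK t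
      obtain ⟨u0, u1⟩ := hub t (Set.Ioo_subset_Icc_self ht)
      have ht1 : t ≤ 1 := ht.2.le.trans ha1
      have B := cutoff_power_second_deriv_bound m k0 k1 k2 ht.1.le ht1 u0 u1 c1 c2 c3 c4
      set v : ℝ := (m + 2) * u t ^ (m + 1) * Q t with hv
      set w : ℝ := (m + 2) * (m + 1) * u t ^ m * (1 - u t) * Q t with hw
      have hv0 : 0 ≤ v := by positivity
      have hw0 : 0 ≤ w := by
        have : 0 ≤ 1 - u t := by linarith
        positivity
      have hp1 : u t ^ (m + 2) ≤ 1 := pow_le_one₀ u0 u1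
      have hp0 : 0 ≤ u t ^ (m + 2) := by positivity
      have hg : |g t| ≤ K := by
        simp only [g]
        rw [abs_mul, abs_of_nonneg hp0]
        calc |χ t| * u t ^ (m + 2) ≤ K * 1 := by gcongr
          _ = K := mul_one K
      have hg' : |g' t| ≤ K * (1 + v) := by
        simp only [g']
        have e1 : |χ' t * u t ^ (m + 2)| ≤ K * 1 := by
          rw [abs_mul, abs_of_nonneg hp0]
          gcongr
        have e2 : |χ t * ((m + 2) * u t ^ (m + 1) * -Q t)| ≤ K * v := by
          rw [abs_mul, mul_neg, abs_neg, ← hv, abs_of_nonneg hv0]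
          gcongr
        calc _ ≤ _ := abs_add_le _ _
          _ ≤ K * 1 + K * v := by gcongr
          _ = _ := by ring
      have hE : ‖E t‖ ≤ 2 * Real.pi * t := by
        simpa [abs_of_pos ht.1] using norm_exp_sub_one_le_mul t
      have hI : ‖(-(2 * Real.pi * Complex.I) : ℂ)‖ = 2 * Real.pi := by
        simp [abs_of_pos Real.pi_pos]
      have n1 : ‖(g'' t : ℂ) * E t‖ ≤ 2 * Real.pi * (t * |g'' t|) := by
        rw [norm_mul, Complex.norm_real, Real.norm_eq_abs]
        calc |g'' t| * ‖E t‖ ≤ |g'' t| * (2 * Real.pi * t) := by gcongr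
          _ = _ := by ring
      have n2 : ‖2 * ((g' t : ℂ) * (-(2 * Real.pi * Complex.I) * e t))‖ =
          4 * Real.pi * |g' t| := by
        rw [norm_mul, norm_mul, norm_mul, hI, ne, Complex.norm_real, Real.norm_eq_abs,
          Complex.norm_ofNat]
        ring
      have n3 : ‖(g t : ℂ) * (-(2 * Real.pi * Complex.I) * (-(2 * Real.pi * Complex.I) * e t))‖ =
          4 * Real.pi ^ 2 * |g t| := by
        rw [norm_mul, norm_mul, norm_mul, hI, ne, Complex.norm_real, Real.norm_eq_abs]
        ring
      refine (norm_add₃_le).trans ?_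
      rw [n2, n3]
      have m1 : 2 * Real.pi * (t * |g'' t|) ≤ 8 * (K * (1 + (2 + C) * v + C * w)) := by
        have : 2 * Real.pi ≤ 8 := by linarith
        exact mul_le_mul this B (by have := ht.1; positivity) (by norm_num)
      have m2 : 4 * Real.pi * |g' t| ≤ 16 * (K * (1 + v)) := by
        have : 4 * Real.pi ≤ 16 := by linarith
        exact mul_le_mul this hg' (abs_nonneg _) (by norm_num)
      have m3 : 4 * Real.pi ^ 2 * |g t| ≤ 64 * K := by
        have : 4 * Real.pi ^ 2 ≤ 64 := by nlinarith
        exact mul_le_mul this hg (abs_nonneg _) (by norm_num)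
      have f1 : 0 ≤ K * v := by positivity
      have f2 : 0 ≤ K * w := by positivity
      have f3 : 0 ≤ K * C := by positivity
      calc _ ≤ 8 * (K * (1 + (2 + C) * v + C * w)) + 16 * (K * (1 + v)) + 64 * K := by
            refine add_le_add (add_le_add (n1.trans m1) m2) m3
        _ ≤ L * (1 + v + w) := by
            rw [hL]
            nlinarith)
    (by simp [E]) (by simp [g, hχa]) (by simp [g, g', hχa, hχa']) hx
  have hsplit : (∫ t in (0 : ℝ)..a, ((χ t * u t ^ (m + 2) : ℝ) : ℂ) *
          Complex.exp (-(2 * Real.pi * Complex.I * (x + 1 : ℤ) * t))) -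
        ∫ t in (0 : ℝ)..a, ((χ t * u t ^ (m + 2) : ℝ) : ℂ) *
          Complex.exp (-(2 * Real.pi * Complex.I * x * t)) =
      ∫ t in (0 : ℝ)..a, (g t : ℂ) * E t * Complex.exp (-(2 * Real.pi * Complex.I * x * t)) := by
    rw [← intervalIntegral.integral_sub]
    · refine intervalIntegral.integral_congr fun t _ => ?_
      simp only [g, E]
      have : Complex.exp (-(2 * Real.pi * Complex.I * (x + 1 : ℤ) * t)) =
          Complex.exp (-(2 * Real.pi * Complex.I * t)) *
            Complex.exp (-(2 * Real.pi * Complex.I * x * t)) := by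
        rw [← Complex.exp_add]
        congr 1
        push_cast
        ring
      rw [this]
      ring
    · exact Continuous.intervalIntegrable (by fun_prop) _ _
    · exact Continuous.intervalIntegrable (by fun_prop) _ _
  rw [hsplit]
  refine key.trans ?_
  have hx' : (0 : ℝ) < (x : ℝ) ^ 2 := by positivity
  refine div_le_div_of_nonneg_right (add_le_add ?_ ?_) hx'.le
  · have hE0 : E 0 = 0 := by simp [E]
    rw [hE0, mul_zero, zero_add, norm_mul, norm_mul, ne, Complex.norm_real, Real.norm_eq_abs]
    have hI : ‖(-(2 * Real.pi * Complex.I) : ℂ)‖ = 2 * Real.pi := by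
      simp [abs_of_pos Real.pi_pos]
    have hg0 : |g 0| ≤ K := by simpa [g, hu0] using (hK 0).1
    rw [hI]
    nlinarith
  · obtain ⟨u0, u1⟩ := hub a ⟨ha.le, le_rfl⟩
    have hp0 : 0 ≤ u a ^ (m + 2) := by positivity
    have hp1 : 0 ≤ u a ^ (m + 1) := by positivity
    have hp2 : u a ^ (m + 2) ≤ u a ^ (m + 1) := pow_le_pow_of_le_one u0 u1 (by omega)
    have hm : (0 : ℝ) ≤ m := by positivity
    have hW : W a - W 0 = L * (a - u a ^ (m + 2) -
        ((m + 2) * u a ^ (m + 1) - (m + 1) * u a ^ (m + 2)) + 2) := by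
      simp only [W, hu0, one_pow]
      ring
    rw [hW]
    have : a - u a ^ (m + 2) - ((m + 2) * u a ^ (m + 1) - (m + 1) * u a ^ (m + 2)) + 2 ≤ 3 := by
      nlinarith
    nlinarith

/-! ### Absolutely summable Fourier coefficients away from the origin -/

theorem fourierCoeffOn_half_eq_integral (hab : (-1 / 2 : ℝ) < 1 / 2) (f : ℝ → ℂ) (x : ℤ) :
    fourierCoeffOn hab f x = ∫ t in (-1 / 2 : ℝ)..(1 / 2),
      f t * Complex.exp (-(2 * Real.pi * Complex.I * x * t)) := by
  rw [fourierCoeffOn_eq_integral]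
  have h1 : (1 / (1 / 2 - -1 / 2) : ℝ) = 1 := by norm_num
  rw [h1, one_smul]
  refine intervalIntegral.integral_congr fun t _ => ?_
  simp only [fourier_coe_apply, smul_eq_mul]
  rw [mul_comm]
  congr 2
  push_cast
  ring

theorem summable_one_div_int_sq : Summable fun x : ℤ => 1 / (x : ℝ) ^ 2 :=
  Real.summable_one_div_int_pow.2 one_lt_two

/-- The Fourier coefficients of a `C¹` function on the circle are absolutely summable. -/
theorem exists_summable_bound_fourier_coeff {g g' : ℝ → ℂ} {s : ℝ} (hs : 0 < s)
    (hg : ∀ t, HasDerivAt g (g' t) t) (hg' : Continuous g')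
    (hper : g (1 / 2) = g (-1 / 2))
    (hb : ∀ t ∈ Set.Icc (-1 / 2 : ℝ) (1 / 2), ‖g t‖ ≤ s ∧ ‖g' t‖ ≤ s) :
    ∃ b : ℤ → ℝ, (∀ x : ℤ, ‖∫ t in (-1 / 2 : ℝ)..(1 / 2),
        g t * Complex.exp (-(2 * Real.pi * Complex.I * x * t))‖ ≤ b x) ∧ Summable b ∧
      ∑' x, b x ≤ (∑' x : ℤ, 1 / (x : ℝ) ^ 2 + 2) * s := by
  have hab : (-1 / 2 : ℝ) < 1 / 2 := by norm_num
  have hgc : Continuous g := continuous_iff_continuousAt.2 fun t => (hg t).continuousAt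
  have hle : ∀ t ∈ Set.uIoc (-1 / 2 : ℝ) (1 / 2), t ∈ Set.Icc (-1 / 2 : ℝ) (1 / 2) := by
    intro t ht
    rw [Set.uIoc_of_le hab.le] at ht
    exact Set.Ioc_subset_Icc_self ht
  have hmem : MemLp g' 2 (volume.restrict (Set.Ioc (-1 / 2 : ℝ) (1 / 2))) := by
    refine MemLp.of_bound hg'.aestronglyMeasurable s ?_
    filter_upwards [ae_restrict_mem measurableSet_Ioc] with t ht
    exact (hb t (Set.Ioc_subset_Icc_self ht)).2
  have hpars := hasSum_sq_fourierCoeffOn hab hmem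
  have hint : ((1 / 2 : ℝ) - -1 / 2)⁻¹ • ∫ t in (-1 / 2 : ℝ)..(1 / 2), ‖g' t‖ ^ 2 ≤ s ^ 2 := by
    have h1 : ((1 / 2 : ℝ) - -1 / 2)⁻¹ = 1 := by norm_num
    rw [h1, one_smul]
    have h2 := intervalIntegral.integral_mono_on (μ := volume) hab.le
      (f := fun t => ‖g' t‖ ^ 2) (g := fun _ => s ^ 2)
      (Continuous.intervalIntegrable (by fun_prop) _ _) intervalIntegrable_const
      fun t ht => by
        have := (hb t ht).2
        gcongr
    refine h2.trans_eq ?_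
    rw [intervalIntegral.integral_const]
    norm_num
  have hsingle : HasSum (Pi.single (0 : ℤ) s : ℤ → ℝ) s := hasSum_pi_single 0 s
  -- The bound is `s/x² + |F(x)|²/s` with `F` the coefficients of `g'`: it dominates `|F(x)|/|x|` by
  -- the arithmetic–geometric mean inequality, and Parseval sums the squares to at most `s²`. As
  -- `1/0² = 0` here, the coefficient at `x = 0` needs its own term `s`.
  have hS := ((summable_one_div_int_sq.hasSum.mul_left s).add (hpars.div_const s)).add hsingle
  refine ⟨_, fun x => ?_, hS.summable, ?_⟩
  · rcases eq_or_ne x 0 with rfl | hx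
    · have h1 : ‖∫ t in (-1 / 2 : ℝ)..(1 / 2),
          g t * Complex.exp (-(2 * Real.pi * Complex.I * (0 : ℤ) * t))‖ ≤
          s * |(1 / 2 : ℝ) - -1 / 2| := by
        refine intervalIntegral.norm_integral_le_of_norm_le_const fun t ht => ?_
        rw [norm_mul, norm_exp_neg_two_pi, mul_one]
        exact (hb t (hle t ht)).1
      have h2 : |(1 / 2 : ℝ) - -1 / 2| = 1 := by norm_num
      rw [h2, mul_one] at h1
      refine h1.trans ?_
      have : 0 ≤ ‖fourierCoeffOn hab g' 0‖ ^ 2 / s := by positivity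
      have : 0 ≤ s * (1 / ((0 : ℤ) : ℝ) ^ 2) := by positivity
      simp only [Pi.single_eq_same]
      linarith
    · rw [← fourierCoeffOn_half_eq_integral hab,
        fourierCoeffOn_of_hasDerivAt hab hx (fun t _ => hg t) (hg'.intervalIntegrable _ _)]
      have hx1 : (0 : ℝ) < |(x : ℝ)| := by simpa using hx
      have e1 : ((1 / 2 : ℝ) : ℂ) - ((-1 / 2 : ℝ) : ℂ) = 1 := by push_cast; norm_num
      rw [hper, sub_self, mul_zero, zero_sub, e1, one_mul, norm_mul, norm_neg]
      set F := ‖fourierCoeffOn hab g' x‖ with hF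
      have hF0 : 0 ≤ F := norm_nonneg _
      have e2 : ‖(1 / (-2 * Real.pi * Complex.I * x) : ℂ)‖ ≤ 1 / |(x : ℝ)| := by
        simp only [norm_div, norm_mul, norm_neg, norm_one, Complex.norm_ofNat, Complex.norm_real,
          Complex.norm_I, Complex.norm_intCast, mul_one, Real.norm_eq_abs,
          abs_of_pos Real.pi_pos]
        refine div_le_div_of_nonneg_left zero_le_one hx1 ?_
        nlinarith [Real.pi_gt_three]
      have hsing : (Pi.single (0 : ℤ) s : ℤ → ℝ) x = 0 := by simp [hx]
      rw [hsing, add_zero]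
      refine (mul_le_mul_of_nonneg_right e2 hF0).trans ?_
      rw [← sq_abs (x : ℝ)]
      have h3 : 1 / |(x : ℝ)| * F = 1 / |(x : ℝ)| * s * (F / s) := by
        field_simp
      have h4 : s * (1 / |(x : ℝ)| ^ 2) = s * (1 / |(x : ℝ)|) ^ 2 := by
        rw [div_pow, one_pow]
      have h5 : F ^ 2 / s = s * (F / s) ^ 2 := by
        field_simp
      rw [h3, h4, h5]
      have h6 : 0 ≤ 1 / |(x : ℝ)| := by positivity
      have h7 : 0 ≤ F / s := by positivity
      nlinarith [sq_nonneg (1 / |(x : ℝ)| - F / s), mul_nonneg h6 h7]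
  · rw [hS.tsum_eq]
    have : (((1 / 2 : ℝ) - -1 / 2)⁻¹ • ∫ t in (-1 / 2 : ℝ)..(1 / 2), ‖g' t‖ ^ 2) / s ≤ s := by
      rw [div_le_iff₀ hs]
      nlinarith
    linarith

/-- The part of `u ^ n` away from `0` has Fourier coefficients with a common summable bound. -/
theorem exists_summable_bound_outer {u u' χ χ' : ℝ → ℝ} {r ρ K : ℝ} (hρ0 : 0 < ρ) (hρ1 : ρ < 1)
    (hK : 1 ≤ K) (hu : ∀ t, HasDerivAt u (u' t) t) (hu' : Continuous u')
    (hχ : ∀ t, HasDerivAt χ (χ' t) t) (hχ' : Continuous χ')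
    (hbd : ∀ t, |χ t| ≤ K ∧ |χ' t| ≤ K)
    (hu'b : ∀ t ∈ Set.Icc (-1 / 2 : ℝ) (1 / 2), |u' t| ≤ K)
    (hin : ∀ t, |t| < r → χ t = 1 ∧ χ' t = 0)
    (hout : ∀ t ∈ Set.Icc (-1 / 2 : ℝ) (1 / 2), r ≤ |t| → |u t| ≤ ρ)
    (hper : u (1 / 2) = u (-1 / 2)) (hχper : χ (1 / 2) = χ (-1 / 2)) :
    ∃ D : ℤ → ℝ, Summable D ∧ ∀ (m : ℕ) (x : ℤ),
      ‖∫ t in (-1 / 2 : ℝ)..(1 / 2), (((1 - χ t) * u t ^ (m + 1) : ℝ) : ℂ) *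
        Complex.exp (-(2 * Real.pi * Complex.I * x * t))‖ ≤ D x := by
  have huc : Continuous u := continuous_iff_continuousAt.2 fun t => (hu t).continuousAt
  have hχc : Continuous χ := continuous_iff_continuousAt.2 fun t => (hχ t).continuousAt
  -- A common bound for `(1-χ)u^{m+1}` and its derivative; `m + 1` comes from differentiating the
  -- power.
  set s : ℕ → ℝ := fun m => 3 * K ^ 2 * ((m + 1) * ρ ^ m) with hs
  have hs0 : ∀ m, 0 < s m := fun m => by positivity
  have hssum : Summable s := by
    refine Summable.mul_left _ ?_
    have h1 := summable_pow_mul_geometric_of_norm_lt_one 1 (r := ρ)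
      (by rwa [Real.norm_of_nonneg hρ0.le])
    have h2 := summable_geometric_of_lt_one hρ0.le hρ1
    refine (h1.add h2).congr fun m => ?_
    ring
  have hex : ∀ m : ℕ, ∃ b : ℤ → ℝ, (∀ x : ℤ, ‖∫ t in (-1 / 2 : ℝ)..(1 / 2),
        (((1 - χ t) * u t ^ (m + 1) : ℝ) : ℂ) *
          Complex.exp (-(2 * Real.pi * Complex.I * x * t))‖ ≤ b x) ∧ Summable b ∧
      ∑' x, b x ≤ (∑' x : ℤ, 1 / (x : ℝ) ^ 2 + 2) * s m := by
    intro m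
    have hder : ∀ t, HasDerivAt (fun t => (1 - χ t) * u t ^ (m + 1))
        (-χ' t * u t ^ (m + 1) + (1 - χ t) * ((m + 1) * u t ^ m * u' t)) t := by
      intro t
      refine (((hχ t).const_sub 1).fun_mul ((hu t).fun_pow (m + 1))).congr_deriv ?_
      simp
    refine exists_summable_bound_fourier_coeff
      (g := fun t => (((1 - χ t) * u t ^ (m + 1) : ℝ) : ℂ))
      (g' := fun t => ((-χ' t * u t ^ (m + 1) +
        (1 - χ t) * ((m + 1) * u t ^ m * u' t) : ℝ) : ℂ)) (hs0 m)
      (fun t => (hder t).ofReal_comp) (by fun_prop) ?_ ?_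
    · simp only [hper, hχper]
    · intro t ht
      simp only [Complex.norm_real, Real.norm_eq_abs]
      rcases lt_or_ge |t| r with h | h
      · obtain ⟨h1, h2⟩ := hin t h
        simp only [h1, h2, sub_self, zero_mul, neg_zero, add_zero, abs_zero]
        exact ⟨(hs0 m).le, (hs0 m).le⟩
      · have k1 := hout t ht h
        obtain ⟨k2, k3⟩ := hbd t
        have k4 := hu'b t ht
        have hm : (0 : ℝ) ≤ m := by positivity
        have p0 : 0 ≤ ρ ^ m := by positivity
        have p1 : |u t ^ (m + 1)| ≤ ρ ^ m := by
          rw [abs_pow]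
          calc |u t| ^ (m + 1) ≤ ρ ^ (m + 1) := by gcongr
            _ ≤ ρ ^ m := pow_le_pow_of_le_one hρ0.le hρ1.le (by omega)
        have p2 : |u t ^ m| ≤ ρ ^ m := by
          rw [abs_pow]
          gcongr
        have p3 : |1 - χ t| ≤ 2 * K := by
          refine (abs_sub _ _).trans ?_
          rw [abs_one]
          linarith
        have hKK : K ≤ K ^ 2 := by nlinarith
        have p4 : K * ρ ^ m ≤ K ^ 2 * ((m + 1) * ρ ^ m) := by
          refine mul_le_mul hKK ?_ p0 (by positivity)
          nlinarith
        have p5 : (0 : ℝ) ≤ K ^ 2 * ((m + 1) * ρ ^ m) := by positivity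
        constructor
        · rw [abs_mul]
          calc |1 - χ t| * |u t ^ (m + 1)| ≤ 2 * K * ρ ^ m := by gcongr
            _ ≤ s m := by rw [hs]; simp only; nlinarith
        · refine (abs_add_le _ _).trans ?_
          rw [abs_mul, abs_mul, abs_neg, abs_mul, abs_mul,
            abs_of_nonneg (by positivity : (0 : ℝ) ≤ m + 1)]
          calc |χ' t| * |u t ^ (m + 1)| + |1 - χ t| * ((m + 1) * |u t ^ m| * |u' t|) ≤
              K * ρ ^ m + 2 * K * ((m + 1) * ρ ^ m * K) := by gcongr
            _ ≤ s m := by rw [hs]; simp only; nlinarith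
  choose b hb1 hb2 hb3 using hex
  have hb0 : ∀ m x, 0 ≤ b m x := fun m x => (norm_nonneg _).trans (hb1 m x)
  have hprod : Summable fun p : ℕ × ℤ => b p.1 p.2 := by
    rw [summable_prod_of_nonneg fun p => hb0 p.1 p.2]
    refine ⟨hb2, Summable.of_nonneg_of_le (fun m => tsum_nonneg (hb0 m)) hb3 (hssum.mul_left _)⟩
  have hswap : Summable fun p : ℤ × ℕ => b p.2 p.1 := hprod.prod_symm
  -- The supremum over `m` is bounded by the sum over `m`, which is affordable because `s` is
  -- summable.
  refine ⟨fun x => ∑' m, b m x, hswap.prod, fun m x => (hb1 m x).trans ?_⟩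
  exact (hswap.prod_factor x).le_tsum m fun j _ => hb0 j x

/-! ### From unit steps to the maximal Hörmander condition -/

/-- Each sign contributes the tail `∑_{k > 2H} H/k² ≤ 2H/(2H+1) ≤ 1` with `H = |h|`. The bound is
uniform in `h`, as the Hörmander condition requires. -/
theorem tsum_abs_div_sq_le_two (h : ℤ) :
    ∑' x : ℤ, (if 2 * |h| < |x| then |(h : ℝ)| / (x : ℝ) ^ 2 else 0) ≤ 2 := by
  obtain ⟨H, hH⟩ : ∃ H : ℕ, |h| = H := ⟨h.natAbs, Int.abs_eq_natAbs h⟩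
  have hHr : |(h : ℝ)| = H := by rw [← Int.cast_abs, hH]; simp
  set F : ℕ → ℝ := fun k => if 2 * H < k then (H : ℝ) / (k : ℝ) ^ 2 else 0 with hF
  have hF0 : ∀ k, 0 ≤ F k := fun k => by
    simp only [F]; split_ifs <;> positivity
  have hFle : ∀ n, ∑ k ∈ Finset.range n, F k ≤ 1 := by
    intro n
    simp only [F]
    rw [← Finset.sum_filter]
    have e : (Finset.range n).filter (fun k => 2 * H < k) = Finset.Ioo (2 * H) n := by
      ext k; simp only [Finset.mem_filter, Finset.mem_range, Finset.mem_Ioo]; omega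
    rw [e]
    simp only [div_eq_mul_inv]
    rw [← Finset.mul_sum]
    have h1 := sum_Ioo_inv_sq_le (α := ℝ) (2 * H) n
    calc (H : ℝ) * _ ≤ H * (2 / ((2 * H : ℕ) + 1)) := by gcongr
      _ ≤ 1 := by
        push_cast
        rw [mul_div_assoc', div_le_one (by positivity)]
        linarith
  have hFs : Summable F := summable_of_sum_range_le hF0 hFle
  have hFt : ∑' k, F k ≤ 1 := Real.tsum_le_of_sum_range_le hF0 hFle
  set f : ℤ → ℝ := fun x => if 2 * |h| < |x| then |(h : ℝ)| / (x : ℝ) ^ 2 else 0 with hf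
  have f1 : ∀ k : ℕ, f k = F k := by
    intro k
    simp only [f, F, hHr, hH, Nat.abs_cast, Int.cast_natCast]
    norm_cast
  have f2 : ∀ k : ℕ, f (-((k : ℤ) + 1)) = F (k + 1) := by
    intro k
    rw [← f1]
    simp only [f, abs_neg]
    push_cast
    congr 2
    ring
  have hs1 : Summable fun k : ℕ => f k := by simpa only [f1] using hFs
  have hs2 : Summable fun k : ℕ => f (-((k : ℤ) + 1)) := by
    simpa only [f2] using (summable_nat_add_iff 1).2 hFs
  rw [tsum_of_nat_of_neg_add_one hs1 hs2]
  simp only [f1, f2]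
  have h3 := hFs.tsum_eq_zero_add
  have := hF0 0
  linarith

/-- The path from `x` to `x + h` stays at distance at least `|x|/2` from `0`, so each of its `|h|`
unit steps costs at most `4M/x²`. -/
theorem norm_sub_le_of_unit_steps {f : ℤ → ℂ} {M : ℝ} (hM : 0 ≤ M)
    (hf : ∀ x : ℤ, x ≠ 0 → ‖f (x + 1) - f x‖ ≤ M / (x : ℝ) ^ 2) {h x : ℤ}
    (hx : 2 * |h| < |x|) : ‖f (x + h) - f x‖ ≤ 4 * M * (|(h : ℝ)| / (x : ℝ) ^ 2) := by
  have hx0 : x ≠ 0 := by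
    rintro rfl
    have := abs_nonneg h
    simp at hx
    omega
  have hxr : (0 : ℝ) < |(x : ℝ)| := by simpa using hx0
  have hstep : ∀ (n : ℕ) (y : ℤ), (∀ i : ℤ, 0 ≤ i → i < n → |x| ≤ 2 * |y + i|) →
      ‖f (y + n) - f y‖ ≤ n * (4 * M / (x : ℝ) ^ 2) := by
    intro n
    induction n with
    | zero => intro y _; simp
    | succ n ih =>
      intro y hy
      have h1 := ih y fun i hi hin => hy i hi (by push_cast; omega)
      have h2 := hy n (by positivity) (by push_cast; omega)
      have h2r : |(x : ℝ)| ≤ 2 * |((y + n : ℤ) : ℝ)| := by exact_mod_cast h2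
      have hne : y + (n : ℤ) ≠ 0 := by
        intro h0
        rw [h0] at h2r
        simp at h2r
        exact hx0 h2r
      have h3 := hf (y + n) hne
      have h4 : M / ((y + n : ℤ) : ℝ) ^ 2 ≤ 4 * M / (x : ℝ) ^ 2 := by
        rw [← sq_abs ((y + n : ℤ) : ℝ), ← sq_abs (x : ℝ)]
        have hyn : 0 < |((y + n : ℤ) : ℝ)| := by linarith
        rw [div_le_div_iff₀ (by positivity) (by positivity)]
        have : |(x : ℝ)| ^ 2 ≤ 4 * |((y + n : ℤ) : ℝ)| ^ 2 := by nlinarith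
        nlinarith
      have e : f (y + ((n + 1 : ℕ) : ℤ)) - f y =
          (f (y + n + 1) - f (y + n)) + (f (y + n) - f y) := by
        push_cast
        rw [add_assoc]
        ring
      rw [e]
      refine (norm_add_le _ _).trans ?_
      push_cast
      linarith
  have hfin : ‖f (x + h) - f x‖ ≤ (h.natAbs : ℕ) * (4 * M / (x : ℝ) ^ 2) := by
    rcases le_total 0 h with h0 | h0
    · have := hstep h.natAbs x fun i hi hin => by
        rw [abs_of_nonneg h0] at hx
        rcases abs_cases x with ⟨e1, _⟩ | ⟨e1, _⟩ <;>
        rcases abs_cases (x + i) with ⟨e2, _⟩ | ⟨e2, _⟩ <;> omega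
      rwa [Int.natAbs_of_nonneg h0] at this
    -- For `h ≤ 0` the path is walked upwards from `x + h` to `x`.
    · have := hstep h.natAbs (x + h) fun i hi hin => by
        rw [abs_of_nonpos h0] at hx
        rcases abs_cases x with ⟨e1, _⟩ | ⟨e1, _⟩ <;>
        rcases abs_cases (x + h + i) with ⟨e2, _⟩ | ⟨e2, _⟩ <;> omega
      rw [Int.ofNat_natAbs_of_nonpos h0, add_neg_cancel_right, norm_sub_rev] at this
      exact this
  refine hfin.trans_eq ?_
  have : ((h.natAbs : ℕ) : ℝ) = |(h : ℝ)| := by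
    rw [← Int.cast_abs, Int.abs_eq_natAbs]; simp
  rw [this]
  ring

/-- Reduction of an even real cutoff integral to the right half line. -/
theorem integral_even_cutoff {v : ℝ → ℝ} (hv : Continuous v) (heven : ∀ t, v (-t) = v t) {a : ℝ}
    (ha : 0 < a) (ha2 : a ≤ 1 / 2) (hsupp : ∀ t, a ≤ |t| → v t = 0) (x : ℤ) :
    ∫ t in (-1 / 2 : ℝ)..(1 / 2), (v t : ℂ) * Complex.exp (-(2 * Real.pi * Complex.I * x * t)) =
      (∫ t in (0 : ℝ)..a, (v t : ℂ) * Complex.exp (-(2 * Real.pi * Complex.I * x * t))) +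
      (starRingEnd ℂ)
        (∫ t in (0 : ℝ)..a, (v t : ℂ) * Complex.exp (-(2 * Real.pi * Complex.I * x * t))) := by
  set F : ℝ → ℂ := fun t => (v t : ℂ) * Complex.exp (-(2 * Real.pi * Complex.I * x * t)) with hF
  have hFc : Continuous F := by fun_prop
  have hint : ∀ a b, IntervalIntegrable F volume a b := fun a b => hFc.intervalIntegrable a b
  have hright : ∫ t in (0 : ℝ)..(1 / 2), F t = ∫ t in (0 : ℝ)..a, F t := by
    rw [← intervalIntegral.integral_add_adjacent_intervals (hint 0 a) (hint a (1 / 2))]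
    have : ∫ t in a..(1 / 2), F t = ∫ t in a..(1 / 2), (0 : ℂ) := by
      refine intervalIntegral.integral_congr fun t ht => ?_
      rw [Set.uIcc_of_le ha2] at ht
      have : v t = 0 := hsupp t (by rw [abs_of_nonneg (ha.le.trans ht.1)]; exact ht.1)
      simp [F, this]
    rw [this]
    simp
  -- Since `v` is real and even, `F(-t)` is the conjugate of `F(t)`.
  have hleft : ∫ t in (-1 / 2 : ℝ)..0, F t = (starRingEnd ℂ) (∫ t in (0 : ℝ)..(1 / 2), F t) := by
    have h1 : ∫ t in (0 : ℝ)..(1 / 2), F (-t) = ∫ t in (-1 / 2 : ℝ)..0, F t := by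
      rw [intervalIntegral.integral_comp_neg]
      norm_num
    rw [← h1, intervalIntegral.integral_of_le (by norm_num),
      intervalIntegral.integral_of_le (by norm_num), ← integral_conj]
    refine integral_congr_ae (Eventually.of_forall fun t => ?_)
    simp only [F, heven, map_mul, Complex.conj_ofReal, ← Complex.exp_conj]
    congr 2
    simp only [Complex.ofReal_neg, map_neg, map_mul, Complex.conj_ofReal, Complex.conj_I,
      map_intCast, map_ofNat]
    ring
  rw [← intervalIntegral.integral_add_adjacent_intervals (hint _ 0) (hint 0 _), hleft, hright,
    add_comm]

/-- A smooth even cutoff together with bounds for its first two derivatives. -/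
theorem exists_cutoff {a : ℝ} (ha : 0 < a) : ∃ (χ χ' χ'' : ℝ → ℝ) (K : ℝ), 1 ≤ K ∧
    (∀ t, HasDerivAt χ (χ' t) t) ∧ (∀ t, HasDerivAt χ' (χ'' t) t) ∧
    (∀ t, |χ t| ≤ K ∧ |χ' t| ≤ K ∧ |χ'' t| ≤ K) ∧ (∀ t, χ (-t) = χ t) ∧
    (∀ t, a ≤ |t| → χ t = 0 ∧ χ' t = 0) ∧ (∀ t, |t| < a / 4 → χ t = 1 ∧ χ' t = 0) := by
  -- The outer radius is below `a`, so the bump vanishes near `|t| = a` and its derivative is `0`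
  -- there too.
  let f : ContDiffBump (0 : ℝ) := ⟨a / 4, a / 2, by linarith, by linarith⟩
  have hf : ContDiff ℝ 2 (f : ℝ → ℝ) := f.contDiff
  have hf1 : ContDiff ℝ 1 (deriv (f : ℝ → ℝ)) :=
    (contDiff_succ_iff_deriv.1 (show ContDiff ℝ (1 + 1) (f : ℝ → ℝ) from f.contDiff)).2.2
  have hf2 : Continuous (deriv (deriv (f : ℝ → ℝ))) := hf1.continuous_deriv le_rfl
  have hcs : HasCompactSupport (f : ℝ → ℝ) := f.hasCompactSupport
  obtain ⟨K0, hK0⟩ := hcs.exists_bound_of_continuous hf.continuous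
  obtain ⟨K1, hK1⟩ := hcs.deriv.exists_bound_of_continuous hf1.continuous
  obtain ⟨K2, hK2⟩ := hcs.deriv.deriv.exists_bound_of_continuous hf2
  refine ⟨f, deriv f, deriv (deriv f), max 1 (max K0 (max K1 K2)), le_max_left _ _,
    fun t => (hf.differentiable (by norm_num) t).hasDerivAt,
    fun t => (hf1.differentiable (by norm_num) t).hasDerivAt, fun t => ⟨?_, ?_, ?_⟩,
    fun t => f.neg t, ?_, ?_⟩
  · exact (hK0 t).trans ((le_max_left _ _).trans (le_max_right _ _))
  · exact (hK1 t).trans ((le_max_left _ _).trans ((le_max_right _ _).trans (le_max_right _ _)))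
  · exact (hK2 t).trans ((le_max_right _ _).trans ((le_max_right _ _).trans (le_max_right _ _)))
  · intro t ht
    have hz : ∀ s : ℝ, a / 2 < |s| → f s = 0 := fun s hs =>
      f.zero_of_le_dist (by simpa [f] using hs.le)
    have hev : ∀ᶠ s in 𝓝 t, f s = 0 := by
      filter_upwards [(isOpen_lt continuous_const continuous_abs).mem_nhds
        (show a / 2 < |t| by linarith)] with s hs
      exact hz s hs
    exact ⟨hev.self_of_nhds, by rw [(show (f : ℝ → ℝ) =ᶠ[𝓝 t] fun _ => 0 from hev).deriv_eq]; simp⟩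
  · intro t ht
    have hev : ∀ᶠ s in 𝓝 t, f s = 1 := by
      filter_upwards [(isOpen_lt continuous_abs continuous_const).mem_nhds ht] with s hs
      exact f.one_of_mem_closedBall (by simpa [f] using (show |s| < a / 4 from hs).le)
    exact ⟨hev.self_of_nhds, by rw [(show (f : ℝ → ℝ) =ᶠ[𝓝 t] fun _ => 1 from hev).deriv_eq]; simp⟩

/-- Near `0` the derivatives of `1 - θ` are comparable with `(1 - θ) / t` and `(1 - θ) / t²`. -/
theorem exists_cosTransform_comparison {μ : ℤ → ℝ} (hμ : IsProbabilityOnInt μ)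
    (hsymm : IsSymmetricOnInt μ) (haper : StrictlyAperiodic μ)
    (hmom : Summable fun k : ℤ => |(k : ℝ)| * μ k) {δ : ℝ} (hδ : 0 < δ)
    (hdiff : ∀ t : ℝ, 0 < |t| → |t| < δ →
      DifferentiableAt ℝ (fourierInt μ) t ∧ DifferentiableAt ℝ (deriv (fourierInt μ)) t)
    (hneg : ∀ t : ℝ, 0 < |t| → |t| < δ → (deriv (deriv (fourierInt μ)) t).re < 0)
    {p : ℝ → ℝ} (hp : MonotoneOn p (Set.Ioo 0 δ))
    (hO : (fun t : ℝ => deriv (deriv (fourierInt μ)) t - (p t : ℂ))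
      =O[𝓝[≠] 0] (fun _ : ℝ => (1 : ℝ))) :
    ∃ (q : ℝ → ℝ) (b C : ℝ), 0 < b ∧ 0 ≤ C ∧ ∀ t, 0 < t → t < b →
      HasDerivAt (fun t => -cosTransformDeriv μ t) (q t) t ∧ 0 ≤ -cosTransformDeriv μ t ∧
        0 ≤ q t ∧ t * q t ≤ C * -cosTransformDeriv μ t ∧
        t * -cosTransformDeriv μ t ≤ C * (1 - cosTransform μ t) := by
  have hF : fourierInt μ = fun t => (cosTransform μ t : ℂ) :=
    funext fun t => fourierInt_eq_cosTransform hμ hsymm t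
  have hF' : deriv (fourierInt μ) = fun t => (cosTransformDeriv μ t : ℂ) := by
    rw [hF]
    funext t
    exact (hasDerivAt_cosTransform hμ hmom t).ofReal_comp.deriv
  set q : ℝ → ℝ := fun t => -(deriv (deriv (fourierInt μ)) t).re with hq
  have hq' : ∀ t, 0 < t → t < δ → HasDerivAt (fun t => -cosTransformDeriv μ t) (q t) t := by
    intro t h0 h1
    have h2 := (hdiff t (by rwa [abs_of_pos h0]) (by rwa [abs_of_pos h0])).2.hasDerivAt
    have h3 := Complex.reCLM.hasFDerivAt.comp_hasDerivAt t h2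
    rw [hF'] at h3
    refine HasDerivAt.fun_neg (f' := (deriv (deriv (fourierInt μ)) t).re) ?_
    rw [hF']
    exact h3
  obtain ⟨D, hD⟩ := hO.bound
  obtain ⟨r, hr0, hr⟩ := Metric.eventually_nhds_iff.1 (eventually_nhdsWithin_iff.1 hD)
  have hD' : ∀ t, 0 < t → t < r → |-(q t) - p t| ≤ D := by
    intro t h0 h1
    have h2 := hr (by simpa [abs_of_pos h0] using h1) h0.ne'
    rw [norm_one, mul_one] at h2
    have h3 := (Complex.abs_re_le_norm _).trans h2
    simpa [q] using h3
  obtain ⟨c, hc, r', hr', hlow⟩ := exists_mul_sq_le_one_sub_cosTransform hμ haper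
  have hD0 : 0 ≤ D := (abs_nonneg _).trans (hD' (r / 2) (by linarith) (by linarith))
  set b := min δ (min r r') with hb
  have hbδ : b ≤ δ := min_le_left _ _
  have hbr : b ≤ r := (min_le_right _ _).trans (min_le_left _ _)
  have hbr' : b ≤ r' := (min_le_right _ _).trans (min_le_right _ _)
  have hqpos : ∀ t, 0 < t → t < b → 0 < q t := fun t h0 h1 => by
    have := hneg t (by rwa [abs_of_pos h0]) (by rw [abs_of_pos h0]; linarith)
    simp only [q]
    linarith
  obtain ⟨C, hC0, hC⟩ := exists_deriv_comparison (φ := fun t => 1 - cosTransform μ t)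
    (Q := fun t => -cosTransformDeriv μ t) (q := q) (b := b) (c := c) (D := 2 * D) hc
    (by positivity) (fun t => (hasDerivAt_cosTransform hμ hmom t).const_sub 1)
    (continuous_cosTransformDeriv hμ hmom).neg (by simp [cosTransformDeriv_zero])
    (by simp [cosTransform_zero hμ]) (fun t h0 h1 => hq' t h0 (h1.trans_le hbδ)) hqpos
    -- Here `q = -θ''` is within `D` of `-p`, which is non-increasing; hence an error of `2D`.
    (fun s t h0 hst h1 => by
      have e1 := abs_le.1 (hD' s h0 (by linarith))
      have e2 := abs_le.1 (hD' t (by linarith) (by linarith))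
      have e3 := hp (a := s) ⟨h0, by linarith⟩ (b := t) ⟨by linarith, by linarith⟩ hst.le
      linarith [e1.1, e1.2, e2.1, e2.2])
    (fun t h0 h1 => hlow t (by rw [abs_of_pos h0]; linarith))
  refine ⟨q, b, C, lt_min hδ (lt_min hr0 hr'), hC0, fun t h0 h1 => ?_⟩
  obtain ⟨k1, k2, k3⟩ := hC t h0 h1
  exact ⟨hq' t h0 (h1.trans_le hbδ), k1, (hqpos t h0 h1).le, k2, k3⟩

/-- The continuous function `|θ|` attains its maximum on this compact set, and the maximum is below
`1` because the only integer in the period is `0`. -/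
theorem exists_abs_cosTransform_le {μ : ℤ → ℝ} (hμ : IsProbabilityOnInt μ)
    (haper : StrictlyAperiodic μ) {r : ℝ} (hr : 0 < r) :
    ∃ ρ, 0 < ρ ∧ ρ < 1 ∧ ∀ t ∈ Set.Icc (-1 / 2 : ℝ) (1 / 2), r ≤ |t| → |cosTransform μ t| ≤ ρ := by
  have hcont := (continuous_cosTransform hμ).abs
  have hK : IsCompact (Set.Icc (-1 / 2 : ℝ) (1 / 2) ∩ {t | r ≤ |t|}) :=
    isCompact_Icc.inter_right (isClosed_le continuous_const continuous_abs)
  rcases (Set.Icc (-1 / 2 : ℝ) (1 / 2) ∩ {t | r ≤ |t|}).eq_empty_or_nonempty with he | hne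
  · refine ⟨1 / 2, by norm_num, by norm_num, fun t ht h => ?_⟩
    have : t ∈ Set.Icc (-1 / 2 : ℝ) (1 / 2) ∩ {t | r ≤ |t|} := ⟨ht, h⟩
    rw [he] at this
    exact this.elim
  · obtain ⟨t0, ht0, hmax⟩ := hK.exists_isMaxOn hne hcont.continuousOn
    have hlt : |cosTransform μ t0| < 1 := by
      refine abs_cosTransform_lt_one hμ haper fun m hm => ?_
      obtain ⟨⟨h1, h2⟩, h3⟩ := ht0
      have h3' : r ≤ |t0| := h3
      rw [hm] at h1 h2 h3'
      have e1 : (-1 : ℝ) < m := by linarith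
      have e2 : (m : ℝ) < 1 := by linarith
      have e3 : -1 < m := by exact_mod_cast e1
      have e4 : m < 1 := by exact_mod_cast e2
      have e5 : m = 0 := by omega
      rw [e5] at h3'
      simp at h3'
      linarith
    refine ⟨max (1 / 2) |cosTransform μ t0|, by positivity, max_lt (by norm_num) hlt,
      fun t ht h => (hmax ⟨ht, h⟩).trans (le_max_right _ _)⟩

/-- The convolution powers of `μ` satisfy a maximal Hörmander condition. -/
theorem exists_hormander_majorant {μ : ℤ → ℝ} (hμ : IsProbabilityOnInt μ)
    (hsymm : IsSymmetricOnInt μ) (haper : StrictlyAperiodic μ)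
    (hmom : Summable fun k : ℤ => |(k : ℝ)| * μ k) {δ : ℝ} (hδ : 0 < δ)
    (hdiff : ∀ t : ℝ, 0 < |t| → |t| < δ →
      DifferentiableAt ℝ (fourierInt μ) t ∧ DifferentiableAt ℝ (deriv (fourierInt μ)) t)
    (hneg : ∀ t : ℝ, 0 < |t| → |t| < δ → (deriv (deriv (fourierInt μ)) t).re < 0)
    {p : ℝ → ℝ} (hp : MonotoneOn p (Set.Ioo 0 δ))
    (hO : (fun t : ℝ => deriv (deriv (fourierInt μ)) t - (p t : ℂ))
      =O[𝓝[≠] 0] (fun _ : ℝ => (1 : ℝ))) :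
    ∃ (Φ : ℤ → ℤ → ℝ) (C : ℝ), (∀ h x, 0 ≤ Φ h x) ∧
      (∀ h, Summable (Φ h) ∧ ∑' x, Φ h x ≤ C) ∧
      ∀ (m : ℕ) (h x : ℤ), 2 * |h| < |x| →
        |convPow μ (m + 2) (x + h) - convPow μ (m + 2) x| ≤ Φ h x := by
  obtain ⟨q, b, C, hb, hC, hloc⟩ :=
    exists_cosTransform_comparison hμ hsymm haper hmom hδ hdiff hneg hp hO
  have huc := continuous_cosTransform hμ
  have huc' := continuous_cosTransformDeriv hμ hmom
  obtain ⟨r, hr, hrpos⟩ : ∃ r > 0, ∀ t, |t| < r → 0 < cosTransform μ t := by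
    have h1 : ∀ᶠ t in 𝓝 (0 : ℝ), 0 < cosTransform μ t :=
      huc.continuousAt.eventually (lt_mem_nhds (by rw [cosTransform_zero hμ]; exact one_pos))
    obtain ⟨r, hr, h⟩ := Metric.eventually_nhds_iff.1 h1
    exact ⟨r, hr, fun t ht => h (by simpa using ht)⟩
  -- On `[0, a]` the derivative comparison must hold and `θ` must be nonnegative; the cutoff must
  -- also fit inside one period.
  obtain ⟨a, ha, hab, har, ha4⟩ : ∃ a : ℝ, 0 < a ∧ a ≤ b ∧ a < r ∧ a ≤ 1 / 4 := by
    refine ⟨min b (min (r / 2) (1 / 4)), by positivity, min_le_left _ _, ?_, ?_⟩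
    · have : min b (min (r / 2) (1 / 4)) ≤ r / 2 := (min_le_right _ _).trans (min_le_left _ _)
      linarith
    · exact (min_le_right _ _).trans (min_le_right _ _)
  obtain ⟨χ, χ', χ'', K, hK1, hχ, hχ', hKb, hχeven, hχout, hχin⟩ := exists_cutoff ha
  have hχc : Continuous χ := continuous_iff_continuousAt.2 fun t => (hχ t).continuousAt
  have hχc' : Continuous χ' := continuous_iff_continuousAt.2 fun t => (hχ' t).continuousAt
  have haa : a ≤ |a| := le_abs_self a
  obtain ⟨M, hM0, hM⟩ := exists_norm_integral_cutoff_power_le (u := cosTransform μ)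
    (Q := fun t => -cosTransformDeriv μ t) (q := q) ha (by linarith) hC
    (fun t => by rw [neg_neg]; exact hasDerivAt_cosTransform hμ hmom t) huc'.neg
    (fun t ht => (hloc t ht.1 (ht.2.trans_le hab)).1) hχ hχ' hKb (hχout a haa).1 (hχout a haa).2
    (cosTransform_zero hμ)
    (fun t ht => ⟨(hrpos t (by rw [abs_of_nonneg ht.1]; linarith [ht.2])).le,
      (abs_le.1 (abs_cosTransform_le_one hμ t)).2⟩)
    (fun t ht => (hloc t ht.1 (ht.2.trans_le hab)).2)
  obtain ⟨ρ, hρ0, hρ1, hρ⟩ := exists_abs_cosTransform_le hμ haper (r := a / 4) (by positivity)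
  obtain ⟨K', hK'⟩ := (isCompact_Icc (a := (-1 / 2 : ℝ)) (b := 1 / 2)).exists_bound_of_continuousOn
    huc'.continuousOn
  have hper : cosTransform μ (1 / 2) = cosTransform μ (-1 / 2) := by
    rw [show (-1 / 2 : ℝ) = -(1 / 2) by norm_num, cosTransform_neg]
  have hχper : χ (1 / 2) = χ (-1 / 2) := by
    rw [show (-1 / 2 : ℝ) = -(1 / 2) by norm_num, hχeven]
  obtain ⟨D, hDs, hD⟩ := exists_summable_bound_outer (u := cosTransform μ) (χ := χ) (r := a / 4)
    (K := max K K') hρ0 hρ1 (hK1.trans (le_max_left _ _))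
    (hasDerivAt_cosTransform hμ hmom) huc' hχ hχc'
    (fun t => ⟨(hKb t).1.trans (le_max_left _ _), (hKb t).2.1.trans (le_max_left _ _)⟩)
    (fun t ht => (hK' t ht).trans (le_max_right _ _)) hχin hρ hper hχper
  have hD0 : ∀ x, 0 ≤ D x := fun x => (norm_nonneg _).trans (hD 0 x)
  have hsumA : ∀ h : ℤ, Summable fun x : ℤ =>
      if 2 * |h| < |x| then |(h : ℝ)| / (x : ℝ) ^ 2 else 0 := by
    intro h
    refine Summable.of_nonneg_of_le (fun x => ?_) (fun x => ?_)
      (summable_one_div_int_sq.mul_left |(h : ℝ)|)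
    · split_ifs <;> positivity
    · split_ifs
      · rw [mul_one_div]
      · positivity
  have hDh : ∀ h : ℤ, HasSum (fun x => D (x + h)) (∑' x, D x) := fun h =>
    (Equiv.addRight h).hasSum_iff.2 hDs.hasSum
  have hΦ : ∀ h : ℤ, HasSum (fun x : ℤ =>
      8 * M * (if 2 * |h| < |x| then |(h : ℝ)| / (x : ℝ) ^ 2 else 0) + (D (x + h) + D x))
      (8 * M * (∑' x : ℤ, if 2 * |h| < |x| then |(h : ℝ)| / (x : ℝ) ^ 2 else 0) +
        (∑' x, D x + ∑' x, D x)) := fun h =>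
    ((hsumA h).hasSum.mul_left _).add ((hDh h).add hDs.hasSum)
  -- In `8M`, a factor `2` comes from the two half lines and `4` from the unit steps. For the outer
  -- part no cancellation is used, only its sizes at `x + h` and `x`.
  refine ⟨fun h x => 8 * M * (if 2 * |h| < |x| then |(h : ℝ)| / (x : ℝ) ^ 2 else 0) +
      (D (x + h) + D x), 8 * M * 2 + (∑' x, D x + ∑' x, D x), fun h x => ?_,
    fun h => ⟨(hΦ h).summable, ?_⟩, fun m h x hx => ?_⟩
  · have := hD0 (x + h)
    have := hD0 x
    beta_reduce
    split_ifs <;> positivity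
  · rw [(hΦ h).tsum_eq]
    have := tsum_abs_div_sq_le_two h
    gcongr
  · simp only [if_pos hx]
    set A : ℤ → ℂ := fun x => ∫ t in (-1 / 2 : ℝ)..(1 / 2),
      ((χ t * cosTransform μ t ^ (m + 2) : ℝ) : ℂ) *
        Complex.exp (-(2 * Real.pi * Complex.I * x * t)) with hA
    set B : ℤ → ℂ := fun x => ∫ t in (-1 / 2 : ℝ)..(1 / 2),
      (((1 - χ t) * cosTransform μ t ^ (m + 2) : ℝ) : ℂ) *
        Complex.exp (-(2 * Real.pi * Complex.I * x * t)) with hB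
    have hAB : ∀ x, (convPow μ (m + 2) x : ℂ) = A x + B x := by
      intro x
      rw [convPow_eq_integral hμ, hA, hB]
      simp only
      rw [← intervalIntegral.integral_add]
      · refine intervalIntegral.integral_congr fun t _ => ?_
        simp only [fourierInt_eq_cosTransform hμ hsymm]
        push_cast
        ring
      · exact Continuous.intervalIntegrable (by fun_prop) _ _
      · exact Continuous.intervalIntegrable (by fun_prop) _ _
    have hAstep : ∀ y : ℤ, y ≠ 0 → ‖A (y + 1) - A y‖ ≤ 2 * M / (y : ℝ) ^ 2 := by
      intro y hy
      have hcut := integral_even_cutoff (v := fun t => χ t * cosTransform μ t ^ (m + 2))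
        (by fun_prop) (fun t => by simp only [hχeven, cosTransform_neg]) ha (by linarith)
        (fun t ht => by simp only [(hχout t ht).1, zero_mul])
      have h1 := hM m y hy
      simp only [hA]
      rw [hcut, hcut, add_sub_add_comm, ← map_sub]
      refine (norm_add_le _ _).trans ?_
      rw [Complex.norm_conj]
      calc _ ≤ M / (y : ℝ) ^ 2 + M / (y : ℝ) ^ 2 := add_le_add h1 h1
        _ = 2 * M / (y : ℝ) ^ 2 := by ring
    have hAh := norm_sub_le_of_unit_steps (by positivity) hAstep hx
    have e : ((convPow μ (m + 2) (x + h) - convPow μ (m + 2) x : ℝ) : ℂ) =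
        (A (x + h) - A x) + (B (x + h) - B x) := by
      push_cast
      rw [hAB, hAB]
      ring
    rw [← Real.norm_eq_abs, ← Complex.norm_real, e]
    refine (norm_add_le _ _).trans (add_le_add (hAh.trans_eq (by ring)) ?_)
    exact (norm_sub_le _ _).trans (add_le_add (hD (m + 1) (x + h)) (hD (m + 1) x))

/-! ### Calderón–Zygmund decomposition on the integers -/

open scoped ENNReal

/-- The average of `f` over the dyadic interval of length `2 ^ j` that contains `x`. -/
noncomputable def dyadicAvg (f : ℤ → ℝ≥0∞) (j : ℕ) (x : ℤ) : ℝ≥0∞ :=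
  ∑' y : ℤ, if y / 2 ^ j = x / 2 ^ j then ((2 : ℝ≥0∞) ^ j)⁻¹ * f y else 0

theorem dyadic_ediv_eq_of_le {i j : ℕ} (hij : i ≤ j) {y z : ℤ}
    (h : y / (2 : ℤ) ^ i = z / 2 ^ i) : y / (2 : ℤ) ^ j = z / 2 ^ j := by
  obtain ⟨k, rfl⟩ := Nat.exists_eq_add_of_le hij
  rw [pow_add, ← Int.ediv_ediv_of_nonneg (by positivity), ← Int.ediv_ediv_of_nonneg (by positivity),
    h]

theorem abs_sub_lt_of_ediv_eq {N y z : ℤ} (hN : 0 < N) (h : y / N = z / N) : |y - z| < N := by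
  have h1 := Int.emod_add_mul_ediv y N
  have h2 := Int.emod_add_mul_ediv z N
  have h3 := Int.emod_nonneg y hN.ne'
  have h4 := Int.emod_nonneg z hN.ne'
  have h5 := Int.emod_lt_of_pos y hN
  have h6 := Int.emod_lt_of_pos z hN
  rw [h] at h1
  rw [abs_lt]
  constructor <;> linarith

theorem tsum_dyadic_cell (j : ℕ) (c : ℤ) :
    ∑' z : ℤ, (if z / 2 ^ j = c then ((2 : ℝ≥0∞) ^ j)⁻¹ else 0) = 1 := by
  have hpos : (0 : ℤ) < 2 ^ j := by positivity
  have hcell : ∀ z : ℤ, z / 2 ^ j = c ↔ z ∈ Finset.Ico (c * 2 ^ j) (c * 2 ^ j + 2 ^ j) := by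
    intro z
    rw [Finset.mem_Ico, Int.ediv_eq_iff_of_pos hpos]
  rw [tsum_eq_sum (s := Finset.Ico (c * 2 ^ j) (c * 2 ^ j + 2 ^ j))]
  · rw [Finset.sum_congr rfl fun z hz => if_pos ((hcell z).2 hz), Finset.sum_const, Int.card_Ico,
      nsmul_eq_mul, add_sub_cancel_left]
    have : (((2 : ℤ) ^ j).toNat : ℝ≥0∞) = 2 ^ j := by
      have : ((2 : ℤ) ^ j).toNat = 2 ^ j := by
        rw [Int.toNat_pow_of_nonneg (by norm_num)]
        rfl
      rw [this]
      push_cast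
      rfl
    rw [this]
    exact ENNReal.mul_inv_cancel (by positivity) (by finiteness)
  · intro z hz
    rw [if_neg]
    rwa [hcell]

/-- The parent interval contains the cell and is twice as long. This bounds the average on a
stopping cell by twice the height. -/
theorem dyadicAvg_le_two_mul (f : ℤ → ℝ≥0∞) (j : ℕ) (x : ℤ) :
    dyadicAvg f j x ≤ 2 * dyadicAvg f (j + 1) x := by
  rw [dyadicAvg, dyadicAvg, ← ENNReal.tsum_mul_left]
  refine ENNReal.tsum_le_tsum fun y => ?_
  by_cases h : y / 2 ^ j = x / (2 : ℤ) ^ j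
  · rw [if_pos h, if_pos (dyadic_ediv_eq_of_le (Nat.le_succ j) h), ← mul_assoc]
    gcongr
    rw [pow_succ, ENNReal.mul_inv (by simp) (by simp), mul_comm, mul_assoc,
      ENNReal.inv_mul_cancel (by simp) (by simp), mul_one]
  · rw [if_neg h]
    exact zero_le

theorem dyadicAvg_congr (f : ℤ → ℝ≥0∞) {j : ℕ} {x y : ℤ} (h : x / 2 ^ j = y / (2 : ℤ) ^ j) :
    dyadicAvg f j x = dyadicAvg f j y := by
  rw [dyadicAvg, dyadicAvg, h]

/-- The Calderón–Zygmund stopping levels of a summable function at height `l`. -/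
theorem exists_stopping_level {f : ℤ → ℝ≥0∞} (hf : ∑' y, f y ≠ ∞) {l : ℝ≥0∞} (hl : l ≠ 0) :
    ∃ τ : ℤ → ℕ, (∀ y z, y / (2 : ℤ) ^ τ z = z / 2 ^ τ z → τ y = τ z) ∧
      (∀ z, dyadicAvg f (τ z) z ≤ 2 * l) ∧ ∀ z, τ z ≠ 0 → l < dyadicAvg f (τ z) z := by
  classical
  -- Averages over long intervals are at most `2⁻ʲ ∑ f`, so every point has a largest level above
  -- height `l`, if any.
  obtain ⟨N, hN⟩ : ∃ N : ℕ, ∀ j, N ≤ j → ∀ x, dyadicAvg f j x ≤ l := by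
    have hb : ∀ j x, dyadicAvg f j x ≤ (2⁻¹ : ℝ≥0∞) ^ j * ∑' y, f y := by
      intro j x
      rw [dyadicAvg, ← ENNReal.tsum_mul_left]
      refine ENNReal.tsum_le_tsum fun y => ?_
      split_ifs
      · rw [ENNReal.inv_pow]
      · exact zero_le
    have ht : Tendsto (fun j : ℕ => (2⁻¹ : ℝ≥0∞) ^ j * ∑' y, f y) atTop (𝓝 (0 * ∑' y, f y)) :=
      ENNReal.Tendsto.mul_const
        (ENNReal.tendsto_pow_atTop_nhds_zero_of_lt_one (by simp)) (Or.inr hf)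
    rw [zero_mul] at ht
    obtain ⟨N, hN⟩ := eventually_atTop.1 (ht.eventually (gt_mem_nhds (pos_iff_ne_zero.2 hl)))
    exact ⟨N, fun j hj x => (hb j x).trans (hN j hj).le⟩
  -- The default value `0` also covers points where no level exceeds `l`. This is harmless: the cell
  -- at level `0` is a single point, so averaging over it changes nothing.
  refine ⟨fun z => Nat.findGreatest (fun j => l < dyadicAvg f j z) N, ?_, ?_, ?_⟩
  · intro y z h
    set t := Nat.findGreatest (fun j => l < dyadicAvg f j z) N with ht
    obtain ⟨h1, h2, h3⟩ := Nat.findGreatest_eq_iff.1 ht.symm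
    refine Nat.findGreatest_eq_iff.2 ⟨h1, fun h0 => ?_, fun n hn hnN => ?_⟩
    · rw [dyadicAvg_congr f h]
      exact h2 h0
    · rw [dyadicAvg_congr f (dyadic_ediv_eq_of_le hn.le h)]
      exact h3 hn hnN
  · intro z
    refine (dyadicAvg_le_two_mul f _ z).trans ?_
    gcongr
    set t := Nat.findGreatest (fun j => l < dyadicAvg f j z) N with ht
    rcases le_or_gt (t + 1) N with h | h
    · exact not_lt.1 ((Nat.findGreatest_eq_iff.1 ht.symm).2.2 (Nat.lt_succ_self t) h)
    · exact hN _ h.le z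
  · intro z hz
    exact (Nat.findGreatest_eq_iff.1 rfl).2.1 hz

theorem tsum_indicator_abs_sub_le (z : ℤ) (j : ℕ) :
    ∑' x : ℤ, (if |z - x| ≤ 3 * 2 ^ j then (1 : ℝ≥0∞) else 0) ≤ 7 * 2 ^ j := by
  have hmem : ∀ x : ℤ, |z - x| ≤ 3 * 2 ^ j ↔ x ∈ Finset.Icc (z - 3 * 2 ^ j) (z + 3 * 2 ^ j) := by
    intro x
    rw [Finset.mem_Icc, abs_le]
    constructor <;> rintro ⟨h1, h2⟩ <;> constructor <;> linarith
  rw [tsum_eq_sum (s := Finset.Icc (z - 3 * 2 ^ j) (z + 3 * 2 ^ j))]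
  · rw [Finset.sum_congr rfl fun x hx => if_pos ((hmem x).2 hx), Finset.sum_const, Int.card_Icc,
      nsmul_eq_mul, mul_one]
    have h1 : (z + 3 * 2 ^ j + 1 - (z - 3 * 2 ^ j)).toNat ≤ 7 * 2 ^ j := by
      have : (1 : ℤ) ≤ 2 ^ j := one_le_pow₀ (by norm_num)
      rw [Int.toNat_le]
      push_cast
      linarith
    exact_mod_cast h1
  · intro x hx
    rw [if_neg]
    rwa [hmem]

/-- Calderón–Zygmund: the maximal operator of a family of nonnegative kernels of mass at most `1`
that satisfy a maximal Hörmander condition has weak type `(1, 1)` on `ℤ`. -/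
theorem weak_type_of_hormander {ι : Type*} {K : ι → ℤ → ℝ≥0∞} {Φ : ℤ → ℤ → ℝ≥0∞} {C : ℝ≥0∞}
    (hK : ∀ i, ∑' x, K i x ≤ 1) (hΦ : ∀ h, ∑' x, Φ h x ≤ C)
    (hKΦ : ∀ i h x, 2 * |h| < |x| → K i (x + h) ≤ K i x + Φ h x)
    (f : ℤ → ℝ≥0∞) {l : ℝ≥0∞} (hl : l ≠ 0) :
    ∑' x, Set.indicator {x | ∃ i, 3 * l < ∑' y, K i (y - x) * f y} (fun _ => l) x ≤
      (7 + C) * ∑' y, f y := by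
  by_cases hf : ∑' y, f y = ∞
  · rw [hf, ENNReal.mul_top (by simp)]
    exact le_top
  obtain ⟨τ, hτ, hgood, hbad⟩ := exists_stopping_level hf hl
  -- The symmetric averaging kernel over stopping cells. Applied to `f` it gives the good function,
  -- which is at most `2l` and has the same sum as `f`.
  let w : ℤ → ℤ → ℝ≥0∞ := fun y z => if z / 2 ^ τ y = y / 2 ^ τ y then ((2 : ℝ≥0∞) ^ τ y)⁻¹ else 0
  have hwsymm : ∀ y z, w y z = w z y := by
    intro y z
    simp only [w]
    by_cases h : z / (2 : ℤ) ^ τ y = y / 2 ^ τ y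
    · have := hτ z y h
      rw [this, if_pos h, if_pos h.symm]
    · rw [if_neg h]
      by_cases h' : y / (2 : ℤ) ^ τ z = z / 2 ^ τ z
      · have e := hτ y z h'
        rw [e] at h
        exact absurd h'.symm h
      · rw [if_neg h']
  have hwsum : ∀ y, ∑' z, w y z = 1 := fun y => tsum_dyadic_cell _ _
  have havg : ∀ z, ∑' y, w z y * f y = dyadicAvg f (τ z) z := by
    intro z
    refine tsum_congr fun y => ?_
    simp only [w]
    split_ifs <;> simp
  have hswap : ∀ F : ℤ → ℤ → ℝ≥0∞, ∑' y, ∑' z, F y z = ∑' z, ∑' y, F y z := fun F =>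
    ENNReal.tsum_comm
  have hgsum : ∑' z, dyadicAvg f (τ z) z = ∑' y, f y := by
    simp only [← havg]
    rw [hswap]
    refine tsum_congr fun y => ?_
    rw [ENNReal.tsum_mul_right]
    simp only [hwsymm _ y, hwsum, one_mul]
  -- `R` is the cost of spreading the mass `f y` over its cell. `V` is at least `1` near a stopping
  -- cell of positive level and replaces the indicator of the exceptional set.
  let R : ℤ → ℝ≥0∞ := fun x => ∑' y, ∑' z, w y z * f y * Φ (y - z) (z - x)
  let V : ℤ → ℝ≥0∞ := fun x => ∑' z, if τ z ≠ 0 then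
    ((2 : ℝ≥0∞) ^ τ z)⁻¹ * (if |z - x| ≤ 3 * 2 ^ τ z then 1 else 0) else 0
  have hR : ∑' x, R x ≤ C * ∑' y, f y := by
    simp only [R]
    rw [hswap, ← ENNReal.tsum_mul_left]
    refine ENNReal.tsum_le_tsum fun y => ?_
    rw [hswap]
    calc ∑' z, ∑' x, w y z * f y * Φ (y - z) (z - x)
        = ∑' z, w y z * f y * ∑' x, Φ (y - z) (z - x) := by simp only [ENNReal.tsum_mul_left]
      _ ≤ ∑' z, w y z * f y * C := by
          refine ENNReal.tsum_le_tsum fun z => ?_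
          gcongr
          exact ((Equiv.subLeft z).tsum_eq (Φ (y - z))).trans_le (hΦ _)
      _ = C * f y := by
          simp only [mul_assoc]
          rw [ENNReal.tsum_mul_right, hwsum, one_mul, mul_comm]
  have hV : l * ∑' x, V x ≤ 7 * ∑' y, f y := by
    simp only [V]
    rw [hswap, ← hgsum, ← ENNReal.tsum_mul_left, ← ENNReal.tsum_mul_left]
    refine ENNReal.tsum_le_tsum fun z => ?_
    by_cases hz : τ z = 0
    · simp [hz]
    · simp only [ne_eq, hz, not_false_eq_true, if_true]
      rw [ENNReal.tsum_mul_left]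
      have h2 : ((2 : ℝ≥0∞) ^ τ z)⁻¹ * 2 ^ τ z = 1 :=
        ENNReal.inv_mul_cancel (by simp) (by simp)
      calc l * (((2 : ℝ≥0∞) ^ τ z)⁻¹ * ∑' x, if |z - x| ≤ 3 * 2 ^ τ z then 1 else 0)
          ≤ dyadicAvg f (τ z) z * (((2 : ℝ≥0∞) ^ τ z)⁻¹ * (7 * 2 ^ τ z)) := by
            gcongr
            · exact (hbad z hz).le
            · exact tsum_indicator_abs_sub_le z (τ z)
        _ = 7 * dyadicAvg f (τ z) z * (((2 : ℝ≥0∞) ^ τ z)⁻¹ * 2 ^ τ z) := by ring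
        _ = 7 * dyadicAvg f (τ z) z := by rw [h2, mul_one]
  have hpoint : ∀ x, Set.indicator {x | ∃ i, 3 * l < ∑' y, K i (y - x) * f y} (fun _ => l) x ≤
      l * V x + R x := by
    intro x
    by_cases hx : x ∈ {x | ∃ i, 3 * l < ∑' y, K i (y - x) * f y}
    swap
    · rw [Set.indicator_of_notMem hx]
      exact zero_le
    rw [Set.indicator_of_mem hx]
    by_cases hstar : ∃ z, τ z ≠ 0 ∧ |z - x| ≤ 2 * 2 ^ τ z
    · obtain ⟨z, hz, hzx⟩ := hstar
      -- Every point of the cell of `z` lies within `2^τ + 2·2^τ` of `x`, which explains the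
      -- constant `3` in `V`.
      have hV1 : 1 ≤ V x := by
        rw [← hwsum z]
        refine ENNReal.tsum_le_tsum fun y => ?_
        simp only [w]
        by_cases h : y / (2 : ℤ) ^ τ z = z / 2 ^ τ z
        · have e := hτ y z h
          have h3 := abs_sub_lt_of_ediv_eq (by positivity) h
          have h4 : |y - x| ≤ 3 * 2 ^ τ z := by
            have := abs_sub_le y z x
            linarith
          rw [if_pos h, e, if_pos hz, if_pos h4, mul_one]
        · rw [if_neg h]
          exact zero_le
      calc l = l * 1 := (mul_one l).symm
        _ ≤ l * V x := by gcongr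
        _ ≤ l * V x + R x := le_self_add
    · push Not at hstar
      obtain ⟨i, hi⟩ := hx
      -- Two points of one cell differ by less than `2^τ`, while `x` is farther than `2·2^τ` from
      -- `z`, so the Hörmander bound applies.
      have hterm : ∀ y z, w y z * (K i (y - x) * f y) ≤
          K i (z - x) * (w z y * f y) + w y z * f y * Φ (y - z) (z - x) := by
        intro y z
        by_cases h : z / (2 : ℤ) ^ τ y = y / 2 ^ τ y
        · have hKle : K i (y - x) ≤ K i (z - x) + Φ (y - z) (z - x) := by
            by_cases h0 : τ y = 0
            · rw [h0] at h
              have : z = y := by simpa using h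
              rw [this]
              exact le_self_add
            · have e := hτ z y h
              have h3 := abs_sub_lt_of_ediv_eq (by positivity) h.symm
              have h4 := hstar z (by rwa [e])
              rw [e] at h4
              have h5 := hKΦ i (y - z) (z - x) (by linarith)
              rwa [show z - x + (y - z) = y - x by ring] at h5
          rw [hwsymm z y]
          calc w y z * (K i (y - x) * f y)
              ≤ w y z * ((K i (z - x) + Φ (y - z) (z - x)) * f y) := by gcongr
            _ = _ := by ring
        · have : w y z = 0 := if_neg h
          rw [this, zero_mul]
          exact zero_le
      have hsum : ∑' y, K i (y - x) * f y ≤ 2 * l + R x := by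
        calc ∑' y, K i (y - x) * f y
            = ∑' y, ∑' z, w y z * (K i (y - x) * f y) := by
              refine tsum_congr fun y => ?_
              rw [ENNReal.tsum_mul_right, hwsum, one_mul]
          _ ≤ ∑' y, ∑' z, (K i (z - x) * (w z y * f y) + w y z * f y * Φ (y - z) (z - x)) :=
              ENNReal.tsum_le_tsum fun y => ENNReal.tsum_le_tsum fun z => hterm y z
          _ = ∑' z, K i (z - x) * dyadicAvg f (τ z) z + R x := by
              simp only [ENNReal.tsum_add]
              rw [hswap fun y z => K i (z - x) * (w z y * f y)]
              simp only [ENNReal.tsum_mul_left, havg]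
              rfl
          _ ≤ ∑' z, K i (z - x) * (2 * l) + R x := by
              gcongr with z
              exact hgood z
          _ ≤ 1 * (2 * l) + R x := by
              rw [ENNReal.tsum_mul_right]
              gcongr
              exact ((Equiv.subRight x).tsum_eq (K i)).trans_le (hK i)
          _ = 2 * l + R x := by rw [one_mul]
      by_cases hltop : l = ∞
      · rw [hltop, ENNReal.mul_top (by simp)] at hi
        exact absurd hi not_top_lt
      -- Of the threshold `3l`, the good function accounts for at most `2l`, which leaves `l < R x`.
      have h6 : 2 * l + l < 2 * l + R x := by
        refine lt_of_eq_of_lt ?_ (hi.trans_le hsum)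
        ring
      have h7 : l ≤ R x := (ENNReal.add_lt_add_iff_left (by finiteness)).1 h6 |>.le
      exact h7.trans le_add_self
  calc _ ≤ ∑' x, (l * V x + R x) := ENNReal.tsum_le_tsum hpoint
    _ = l * ∑' x, V x + ∑' x, R x := by rw [ENNReal.tsum_add, ENNReal.tsum_mul_left]
    _ ≤ 7 * ∑' y, f y + C * ∑' y, f y := add_le_add hV hR
    _ = (7 + C) * ∑' y, f y := by ring

/-! ### Transference to a measure preserving system -/

section transference

variable {X : Type*} [MeasurableSpace X]

theorem measurePreserving_perm_zpow {P : Measure X} {T : X ≃ᵐ X} (hT : MeasurePreserving T P P)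
    (k : ℤ) : MeasurePreserving (fun x => ((T.toEquiv : Equiv.Perm X) ^ k) x) P P := by
  have hnat : ∀ n : ℕ, MeasurePreserving (fun x => ((T.toEquiv : Equiv.Perm X) ^ n) x) P P := by
    intro n
    have h := hT.iterate n
    have e : (T : X → X)^[n] = fun x => ((T.toEquiv : Equiv.Perm X) ^ n) x := by
      rw [Equiv.Perm.coe_pow]
      rfl
    rwa [e] at h
  have hnat' : ∀ n : ℕ,
      MeasurePreserving (fun x => ((T.toEquiv : Equiv.Perm X) ^ (-(n : ℤ))) x) P P := by
    intro n
    have h := (hT.symm T).iterate n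
    have e : (T.symm : X → X)^[n] = fun x => ((T.toEquiv : Equiv.Perm X) ^ (-(n : ℤ))) x := by
      rw [zpow_neg, zpow_natCast, ← inv_pow, Equiv.Perm.coe_pow]
      rfl
    rwa [e] at h
  obtain ⟨n, rfl | rfl⟩ := Int.eq_nat_or_neg k
  · simpa using hnat n
  · exact hnat' n

theorem perm_zpow_add_apply (T : X ≃ᵐ X) (a b : ℤ) (x : X) :
    ((T.toEquiv : Equiv.Perm X) ^ (a + b)) x =
      ((T.toEquiv : Equiv.Perm X) ^ a) (((T.toEquiv : Equiv.Perm X) ^ b) x) := by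
  rw [zpow_add, Equiv.Perm.mul_apply]

/-- The ratio `(2(L+M)+1)/(2L+1)` tends to `1`: the boundary loss in transference is negligible for
long orbit segments. -/
theorem ENNReal.le_of_forall_linear_mul_le {a b : ℝ≥0∞} (M : ℕ)
    (h : ∀ L : ℕ, (2 * L + 1 : ℕ) * a ≤ (2 * (L + M) + 1 : ℕ) * b) : a ≤ b := by
  by_cases hb : b = ∞
  · rw [hb]; exact le_top
  refine ENNReal.le_of_forall_pos_le_add fun ε hε _ => ?_
  have hε' : (ε : ℝ≥0∞) ≠ 0 := by exact_mod_cast hε.ne'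
  obtain ⟨L, hL⟩ := ENNReal.exists_nat_gt (r := (2 * M : ℕ) * b / ε)
    (ENNReal.div_ne_top (by finiteness) hε')
  have h1 : ((2 * M : ℕ) : ℝ≥0∞) * b ≤ (2 * L + 1 : ℕ) * ε := by
    rw [ENNReal.div_lt_iff (Or.inl hε') (Or.inl (by finiteness))] at hL
    refine hL.le.trans ?_
    gcongr
    omega
  have h2 : ((2 * L + 1 : ℕ) : ℝ≥0∞) * a ≤ (2 * L + 1 : ℕ) * (b + ε) := by
    refine (h L).trans ?_
    calc ((2 * (L + M) + 1 : ℕ) : ℝ≥0∞) * b = (2 * L + 1 : ℕ) * b + (2 * M : ℕ) * b := by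
          push_cast; ring
      _ ≤ (2 * L + 1 : ℕ) * b + (2 * L + 1 : ℕ) * ε := by gcongr
      _ = _ := by ring
  exact (ENNReal.mul_le_mul_iff_right (by simp) (ENNReal.natCast_ne_top _)).1 h2

/-- Calderón transference of the weak type inequality from `ℤ` to a measure preserving system. -/
theorem weak_type_transference {ι : Type*} [Countable ι] {K : ι → ℤ → ℝ≥0∞} {C : ℝ≥0∞}
    {l : ℝ≥0∞}
    (hweak : ∀ f : ℤ → ℝ≥0∞,
      ∑' x, Set.indicator {x | ∃ i, 3 * l < ∑' y, K i (y - x) * f y} (fun _ => l) x ≤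
        C * ∑' y, f y)
    {P : Measure X} {T : X ≃ᵐ X} (hT : MeasurePreserving T P P) {f : X → ℝ≥0∞}
    (hf : Measurable f) :
    l * P {x | ∃ i, 3 * l < ∑' k, K i k * f (((T.toEquiv : Equiv.Perm X) ^ k) x)} ≤
      C * ∫⁻ x, f x ∂P := by
  set S : ℤ → X → X := fun k x => ((T.toEquiv : Equiv.Perm X) ^ k) x with hS
  have hSmp : ∀ k, MeasurePreserving (S k) P P := measurePreserving_perm_zpow hT
  -- Truncating to `|k| ≤ M` makes the set measurable and dependent only on a finite stretch of the
  -- orbit; the sets increase to cover the one wanted.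
  let E : ℕ → Set X := fun M =>
    {x | ∃ i, 3 * l < ∑ k ∈ Finset.Icc (-(M : ℤ)) M, K i k * f (S k x)}
  have hEmeas : ∀ M, MeasurableSet (E M) := by
    intro M
    have : E M = ⋃ i, {x | 3 * l < ∑ k ∈ Finset.Icc (-(M : ℤ)) M, K i k * f (S k x)} := by
      ext x; simp [E]
    rw [this]
    refine MeasurableSet.iUnion fun i => measurableSet_lt measurable_const ?_
    exact Finset.measurable_fun_sum _ fun k _ =>
      (hf.comp (hSmp k).measurable).const_mul _
  have hEmono : Monotone E := by
    rintro M N hMN x ⟨i, hi⟩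
    refine ⟨i, hi.trans_le (Finset.sum_le_sum_of_subset ?_)⟩
    have : (M : ℤ) ≤ N := by exact_mod_cast hMN
    exact Finset.Icc_subset_Icc (by omega) this
  have hEunion : {x | ∃ i, 3 * l < ∑' k, K i k * f (S k x)} ⊆ ⋃ M, E M := by
    rintro x ⟨i, hi⟩
    rw [ENNReal.tsum_eq_iSup_sum] at hi
    obtain ⟨s, hs⟩ := lt_iSup_iff.1 hi
    refine Set.mem_iUnion.2 ⟨s.sup Int.natAbs, i, hs.trans_le (Finset.sum_le_sum_of_subset ?_)⟩
    intro k hk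
    have := Finset.le_sup (f := Int.natAbs) hk
    rw [Finset.mem_Icc]
    omega
  have hbound : ∀ M, l * P (E M) ≤ C * ∫⁻ x, f x ∂P := by
    intro M
    refine ENNReal.le_of_forall_linear_mul_le M fun L => ?_
    -- The inequality on `ℤ` is applied to `f` along the orbit of `x`, cut off to `[-(L+M), L+M]`,
    -- the window seen from points with `|m| ≤ L`.
    have hpt : ∀ x, ∑ m ∈ Finset.Icc (-(L : ℤ)) L, (E M).indicator (fun _ => l) (S m x) ≤
        C * ∑ y ∈ Finset.Icc (-((L + M : ℕ) : ℤ)) (L + M : ℕ), f (S y x) := by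
      intro x
      let F : ℤ → ℝ≥0∞ := fun y =>
        if y ∈ Finset.Icc (-((L + M : ℕ) : ℤ)) (L + M : ℕ) then f (S y x) else 0
      have hF : ∑' y, F y = ∑ y ∈ Finset.Icc (-((L + M : ℕ) : ℤ)) (L + M : ℕ), f (S y x) := by
        rw [tsum_eq_sum (s := Finset.Icc (-((L + M : ℕ) : ℤ)) (L + M : ℕ))
          fun y hy => if_neg hy]
        exact Finset.sum_congr rfl fun y hy => if_pos hy
      rw [← hF]
      refine le_trans ?_ (hweak F)
      refine le_trans (Finset.sum_le_sum fun m hm => ?_) (ENNReal.sum_le_tsum _)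
      by_cases hmem : S m x ∈ E M
      swap
      · rw [Set.indicator_of_notMem hmem]
        exact zero_le
      obtain ⟨i, hi⟩ := hmem
      have hm' : m ∈ {x | ∃ i, 3 * l < ∑' y, K i (y - x) * F y} := by
        refine ⟨i, hi.trans_le ?_⟩
        calc ∑ k ∈ Finset.Icc (-(M : ℤ)) M, K i k * f (S k (S m x))
            = ∑ k ∈ Finset.Icc (-(M : ℤ)) M, K i (k + m - m) * F (k + m) := by
              refine Finset.sum_congr rfl fun k hk => ?_
              have hmem2 : k + m ∈ Finset.Icc (-((L + M : ℕ) : ℤ)) (L + M : ℕ) := by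
                rw [Finset.mem_Icc] at hk hm ⊢
                push_cast
                omega
              simp only [F, if_pos hmem2]
              rw [add_sub_cancel_right]
              simp only [S, perm_zpow_add_apply]
          _ ≤ ∑' k, K i (k + m - m) * F (k + m) := ENNReal.sum_le_tsum _
          _ = ∑' y, K i (y - m) * F y :=
              (Equiv.addRight m).tsum_eq fun y => K i (y - m) * F y
      rw [Set.indicator_of_mem hm']
      exact Set.indicator_le_self' (fun _ _ => zero_le) _
    have hint := lintegral_mono (μ := P) hpt
    have hm1 : ∀ m : ℤ, Measurable fun x => (E M).indicator (fun _ => l) (S m x) := fun m =>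
      (measurable_const.indicator (hEmeas M)).comp (hSmp m).measurable
    have hm2 : ∀ y : ℤ, Measurable fun x => f (S y x) := fun y => hf.comp (hSmp y).measurable
    rw [lintegral_finsetSum _ fun m _ => hm1 m,
      lintegral_const_mul _ (Finset.measurable_fun_sum _ fun y _ => hm2 y),
      lintegral_finsetSum _ fun y _ => hm2 y] at hint
    have e1 : ∀ m : ℤ, ∫⁻ x, (E M).indicator (fun _ => l) (S m x) ∂P = l * P (E M) := by
      intro m
      rw [(hSmp m).lintegral_comp (measurable_const.indicator (hEmeas M)),
        lintegral_indicator_const (hEmeas M)]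
    have e2 : ∀ y : ℤ, ∫⁻ x, f (S y x) ∂P = ∫⁻ x, f x ∂P := fun y => (hSmp y).lintegral_comp hf
    simp only [e1, e2, Finset.sum_const, Int.card_Icc, nsmul_eq_mul] at hint
    have c1 : ((L : ℤ) + 1 - -(L : ℤ)).toNat = 2 * L + 1 := by omega
    have c2 : (((L + M : ℕ) : ℤ) + 1 - -((L + M : ℕ) : ℤ)).toNat = 2 * (L + M) + 1 := by omega
    rw [c1, c2] at hint
    refine hint.trans_eq ?_
    ring
  calc l * P {x | ∃ i, 3 * l < ∑' k, K i k * f (S k x)} ≤ l * P (⋃ M, E M) := by gcongr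
    _ = ⨆ M, l * P (E M) := by
        rw [hEmono.measure_iUnion, ENNReal.mul_iSup]
    _ ≤ C * ∫⁻ x, f x ∂P := iSup_le hbound

end transference

/-! ### Asymptotic translation invariance of the convolution powers -/

/-- Dominated convergence in the Fourier inversion formula: `|θ| < 1` off the integers, a null set.
-/
theorem tendsto_convPow_zero {μ : ℤ → ℝ} (hμ : IsProbabilityOnInt μ)
    (hsymm : IsSymmetricOnInt μ) (haper : StrictlyAperiodic μ) (x : ℤ) :
    Tendsto (fun n => convPow μ n x) atTop (𝓝 0) := by
  have hFc := continuous_fourierInt hμ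
  have h : Tendsto (fun n : ℕ => ∫ t in (-1 / 2 : ℝ)..(1 / 2),
      fourierInt μ t ^ n * Complex.exp (-(2 * Real.pi * Complex.I * x * t))) atTop
      (𝓝 (∫ t in (-1 / 2 : ℝ)..(1 / 2), (0 : ℂ))) := by
    refine intervalIntegral.tendsto_integral_filter_of_dominated_convergence (fun _ => 1)
      (Eventually.of_forall fun n => Continuous.aestronglyMeasurable (by fun_prop))
      (Eventually.of_forall fun n => Eventually.of_forall fun t _ => ?_)
      intervalIntegrable_const ?_
    · rw [norm_mul, norm_exp_neg_two_pi, mul_one, norm_pow]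
      exact pow_le_one₀ (norm_nonneg _) (norm_fourierInt_le_one hμ t)
    · have hne : ∀ᵐ t : ℝ, ∀ m : ℤ, t ≠ m := by
        rw [ae_all_iff]
        intro m
        rw [ae_iff]
        simp
      filter_upwards [hne] with t ht _
      have h1 : ‖fourierInt μ t‖ < 1 := by
        rw [fourierInt_eq_cosTransform hμ hsymm, Complex.norm_real]
        exact abs_cosTransform_lt_one hμ haper ht
      simpa using (tendsto_pow_atTop_nhds_zero_of_norm_lt_one h1).mul_const
        (Complex.exp (-(2 * Real.pi * Complex.I * x * t)))
  simp only [← convPow_eq_integral hμ, intervalIntegral.integral_zero] at h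
  have h2 := (Complex.continuous_re.tendsto 0).comp h
  simpa [Function.comp_def] using h2

theorem summable_abs_convPow_sub {μ : ℤ → ℝ} (hμ : IsProbabilityOnInt μ) (n : ℕ) (i : ℤ) :
    Summable fun x => |convPow μ n (x + i) - convPow μ n x| := by
  have h1 := (isProbabilityOnInt_convPow hμ n).2.summable
  exact (((Equiv.addRight i).summable_iff.2 h1).sub h1).abs

/-- Translations move the convolution powers by a vanishing amount in `ℓ¹`. -/
theorem tendsto_tsum_abs_convPow_sub {μ : ℤ → ℝ} (hμ : IsProbabilityOnInt μ)
    (hzero : ∀ x, Tendsto (fun n => convPow μ n x) atTop (𝓝 0))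
    {Φ : ℤ → ℤ → ℝ} (hΦ0 : ∀ h x, 0 ≤ Φ h x) (hΦ : ∀ h, Summable (Φ h))
    (hK : ∀ (m : ℕ) (h x : ℤ), 2 * |h| < |x| →
      |convPow μ (m + 2) (x + h) - convPow μ (m + 2) x| ≤ Φ h x) (i : ℤ) :
    Tendsto (fun n => ∑' x, |convPow μ n (x + i) - convPow μ n x|) atTop (𝓝 0) := by
  rw [← tendsto_add_atTop_iff_nat 2]
  have hfin : Summable fun x : ℤ => if |x| ≤ 2 * |i| then (1 : ℝ) else 0 := by
    refine summable_of_ne_finset_zero (s := Finset.Icc (-(2 * |i|)) (2 * |i|)) fun x hx => ?_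
    rw [if_neg]
    rwa [abs_le, ← Finset.mem_Icc]
  -- The Hörmander majorant dominates for `|x| > 2|i|`; on the finitely many remaining `x` the
  -- difference is at most `1`.
  have h := tendsto_tsum_of_dominated_convergence
    (f := fun m x => |convPow μ (m + 2) (x + i) - convPow μ (m + 2) x|) (g := fun _ : ℤ => (0 : ℝ))
    (𝓕 := atTop) ((hΦ i).add hfin) (fun x => ?_) (Eventually.of_forall fun m x => ?_)
  · simpa using h
  · have h1 := ((hzero (x + i)).sub (hzero x)).abs
    rw [sub_zero, abs_zero] at h1
    exact (tendsto_add_atTop_iff_nat 2).2 h1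
  · rw [Real.norm_of_nonneg (abs_nonneg _)]
    by_cases hx : |x| ≤ 2 * |i|
    · rw [if_pos hx]
      have h1 := (isProbabilityOnInt_convPow hμ (m + 2)).1 (x + i)
      have h2 := convPow_le_one hμ (m + 2) (x + i)
      have h3 := (isProbabilityOnInt_convPow hμ (m + 2)).1 x
      have h4 := convPow_le_one hμ (m + 2) x
      have h5 : |convPow μ (m + 2) (x + i) - convPow μ (m + 2) x| ≤ 1 := by
        rw [abs_le]; constructor <;> linarith
      linarith [hΦ0 i x]
    · rw [if_neg hx, add_zero]
      exact hK m i x (not_le.1 hx)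

/-! ### The operators on the system and the mean ergodic theorem -/

section operator

variable {X : Type*} [MeasurableSpace X] {μ : ℤ → ℝ} {P : Measure X} {T : X ≃ᵐ X}

/-- By Tonelli and invariance of the measure, the sum of the absolute values has integral `‖f‖₁`,
hence is finite almost everywhere. -/
theorem ae_summable_convPowTerm (hμ : IsProbabilityOnInt μ) (hT : MeasurePreserving T P P)
    {f : X → ℂ} (hf : Integrable f P) :
    ∀ᵐ x ∂P, ∀ n, Summable (convPowTerm μ T f n x) := by
  rw [ae_all_iff]
  intro n
  have hSmp := measurePreserving_perm_zpow hT
  have hprob := isProbabilityOnInt_convPow hμ n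
  have hmeas : ∀ k : ℤ, AEMeasurable (fun x => ‖convPowTerm μ T f n x k‖ₑ) P := fun k =>
    ((hf.aestronglyMeasurable.comp_measurePreserving (hSmp k)).const_mul
      (convPow μ n k : ℂ)).enorm
  have hint : ∫⁻ x, ∑' k, ‖convPowTerm μ T f n x k‖ₑ ∂P ≠ ∞ := by
    rw [lintegral_tsum hmeas]
    have e : ∀ k : ℤ, ∫⁻ x, ‖convPowTerm μ T f n x k‖ₑ ∂P =
        ENNReal.ofReal (convPow μ n k) * ∫⁻ x, ‖f x‖ₑ ∂P := by
      intro k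
      simp only [convPowTerm, enorm_mul]
      have h1 : ‖((convPow μ n k : ℝ) : ℂ)‖ₑ = ENNReal.ofReal (convPow μ n k) := by
        rw [← ofReal_norm, Complex.norm_real, Real.norm_of_nonneg (hprob.1 k)]
      have h2 : ∫⁻ x, ‖f (((T.toEquiv : Equiv.Perm X) ^ k) x)‖ₑ ∂P = ∫⁻ x, ‖f x‖ₑ ∂P := by
        nth_rewrite 2 [← (hSmp k).map_eq]
        rw [lintegral_map' (by rw [(hSmp k).map_eq]; exact hf.aestronglyMeasurable.enorm)
          (hSmp k).aemeasurable]
      rw [h1, ← h2]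
      exact lintegral_const_mul'' _
        (hf.aestronglyMeasurable.comp_measurePreserving (hSmp k)).enorm
    simp only [e]
    rw [ENNReal.tsum_mul_right, ← ENNReal.ofReal_tsum_of_nonneg hprob.1 hprob.2.summable]
    exact ENNReal.mul_ne_top ENNReal.ofReal_ne_top hf.2.ne
  filter_upwards [ae_lt_top' (AEMeasurable.tsum hmeas) hint] with x hx
  refine Summable.of_norm ?_
  have := ENNReal.tsum_coe_ne_top_iff_summable.1 hx.ne
  exact NNReal.summable_coe.2 this

end operator

section operator

variable {X : Type*} [MeasurableSpace X] {μ : ℤ → ℝ} {P : Measure X} {T : X ≃ᵐ X}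

theorem summable_convPowTerm_of_bounded (hμ : IsProbabilityOnInt μ) {f : X → ℂ} {B : ℝ}
    (hB : ∀ x, ‖f x‖ ≤ B) (n : ℕ) (x : X) : Summable (convPowTerm μ T f n x) := by
  have hprob := isProbabilityOnInt_convPow hμ n
  refine Summable.of_norm_bounded (hprob.2.summable.mul_right B) fun k => ?_
  rw [convPowTerm, norm_mul, Complex.norm_real, Real.norm_of_nonneg (hprob.1 k)]
  exact mul_le_mul_of_nonneg_left (hB _) (hprob.1 k)

/-- Moving the base point by `Tⁱ` translates the kernel, so only the `ℓ¹` distance between `μⁿ` and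
its translate matters. -/
theorem norm_convPowOp_sub_le (hμ : IsProbabilityOnInt μ) {f : X → ℂ} {B : ℝ}
    (hB : ∀ x, ‖f x‖ ≤ B) (n : ℕ) (i : ℤ) (x : X) :
    ‖convPowOp μ T f n x - convPowOp μ T f n (((T.toEquiv : Equiv.Perm X) ^ i) x)‖ ≤
      (∑' k, |convPow μ n (k + -i) - convPow μ n k|) * B := by
  have h1 : convPowOp μ T f n (((T.toEquiv : Equiv.Perm X) ^ i) x) =
      ∑' k : ℤ, (convPow μ n (k + -i) : ℂ) * f (((T.toEquiv : Equiv.Perm X) ^ k) x) := by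
    rw [convPowOp, ← (Equiv.addRight i).tsum_eq (fun k : ℤ =>
      (convPow μ n (k + -i) : ℂ) * f (((T.toEquiv : Equiv.Perm X) ^ k) x))]
    refine tsum_congr fun k => ?_
    simp only [convPowTerm, Equiv.coe_addRight, add_neg_cancel_right, perm_zpow_add_apply]
  have hs1 := summable_convPowTerm_of_bounded (T := T) hμ hB n x
  have hs2 : Summable fun k : ℤ =>
      (convPow μ n (k + -i) : ℂ) * f (((T.toEquiv : Equiv.Perm X) ^ k) x) := by
    rw [← (Equiv.addRight i).summable_iff]
    refine (summable_convPowTerm_of_bounded (T := T) hμ hB n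
      (((T.toEquiv : Equiv.Perm X) ^ i) x)).congr fun k => ?_
    simp only [Function.comp_apply, convPowTerm, Equiv.coe_addRight, add_neg_cancel_right,
      perm_zpow_add_apply]
  rw [h1, convPowOp, ← hs1.tsum_sub hs2]
  refine tsum_of_norm_bounded ((summable_abs_convPow_sub hμ n (-i)).hasSum.mul_right B)
    fun k => ?_
  rw [convPowTerm, ← sub_mul, norm_mul, ← Complex.ofReal_sub, Complex.norm_real, Real.norm_eq_abs,
    abs_sub_comm]
  exact mul_le_mul_of_nonneg_left (hB _) (abs_nonneg _)

/-- The Cesàro average of `f` along the orbit of `T`. -/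
noncomputable def orbitAvg (T : X ≃ᵐ X) (f : X → ℂ) (N : ℕ) (x : X) : ℂ :=
  (N : ℂ)⁻¹ * ∑ i ∈ Finset.range N, f (((T.toEquiv : Equiv.Perm X) ^ (i : ℤ)) x)

/-- `f - A_N f` is the mean of the differences `f - f ∘ Tⁱ`, and each of these is sent to `0` by
asymptotic translation invariance. -/
theorem tendsto_convPowOp_sub_orbitAvg (hμ : IsProbabilityOnInt μ)
    (hV : ∀ i : ℤ, Tendsto (fun n => ∑' x, |convPow μ n (x + i) - convPow μ n x|) atTop (𝓝 0))
    {f : X → ℂ} {B : ℝ} (hB : ∀ x, ‖f x‖ ≤ B) {N : ℕ} (hN : N ≠ 0) (x : X) :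
    Tendsto (fun n => convPowOp μ T (fun y => f y - orbitAvg T f N y) n x) atTop (𝓝 0) := by
  have hN' : (N : ℂ) ≠ 0 := by exact_mod_cast hN
  have hdiff : ∀ i : ℤ, Tendsto (fun n => convPowOp μ T f n x -
      convPowOp μ T f n (((T.toEquiv : Equiv.Perm X) ^ i) x)) atTop (𝓝 0) := by
    intro i
    refine squeeze_zero_norm (fun n => norm_convPowOp_sub_le hμ hB n i x) ?_
    simpa using (hV (-i)).mul_const B
  have hlin : ∀ n, convPowOp μ T (fun y => f y - orbitAvg T f N y) n x =
      (N : ℂ)⁻¹ * ∑ i ∈ Finset.range N, (convPowOp μ T f n x -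
        convPowOp μ T f n (((T.toEquiv : Equiv.Perm X) ^ (i : ℤ)) x)) := by
    intro n
    have hs : ∀ y, HasSum (convPowTerm μ T f n y) (convPowOp μ T f n y) := fun y =>
      (summable_convPowTerm_of_bounded (T := T) hμ hB n y).hasSum
    have h1 := (hasSum_sum fun i (_ : i ∈ Finset.range N) => (hs x).sub
      (hs (((T.toEquiv : Equiv.Perm X) ^ (i : ℤ)) x))).mul_left (N : ℂ)⁻¹
    rw [← h1.tsum_eq, convPowOp]
    refine tsum_congr fun k => ?_
    simp only [convPowTerm, orbitAvg, ← perm_zpow_add_apply, Finset.sum_sub_distrib,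
      Finset.sum_const, Finset.card_range, nsmul_eq_mul, ← Finset.mul_sum]
    rw [mul_sub, mul_sub, inv_mul_cancel_left₀ hN']
    simp only [add_comm k]
    ring
  simp only [hlin]
  have h2 := (tendsto_finsetSum (Finset.range N) fun i _ => hdiff (i : ℤ)).const_mul (N : ℂ)⁻¹
  simpa using h2

theorem ae_convPowOp_eq_of_invariant (hμ : IsProbabilityOnInt μ) (hT : MeasurePreserving T P P)
    {g : X → ℂ} (hg : g ∘ T =ᵐ[P] g) : ∀ᵐ x ∂P, ∀ n, convPowOp μ T g n x = g x := by
  have hSmp := measurePreserving_perm_zpow hT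
  have hinv : ∀ᵐ x ∂P, ∀ k : ℤ, g (T (((T.toEquiv : Equiv.Perm X) ^ k) x)) =
      g (((T.toEquiv : Equiv.Perm X) ^ k) x) := by
    rw [ae_all_iff]
    intro k
    exact (hSmp k).quasiMeasurePreserving.ae hg
  filter_upwards [hinv] with x hx n
  have hsucc : ∀ k : ℤ, g (((T.toEquiv : Equiv.Perm X) ^ (k + 1)) x) =
      g (((T.toEquiv : Equiv.Perm X) ^ k) x) := by
    intro k
    rw [add_comm, perm_zpow_add_apply, zpow_one]
    exact hx k
  have hconst : ∀ k : ℤ, g (((T.toEquiv : Equiv.Perm X) ^ k) x) = g x := by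
    intro k
    induction k using Int.induction_on with
    | zero => simp
    | succ k ih => rw [hsucc, ih]
    | pred k ih =>
      rw [← ih, ← hsucc, sub_add_cancel]
  have hprob := isProbabilityOnInt_convPow hμ n
  simp only [convPowOp, convPowTerm, hconst]
  rw [tsum_mul_right, ← Complex.ofReal_tsum, hprob.2.tsum_eq]
  simp

theorem measurable_orbitAvg {f : X → ℂ} (hT : MeasurePreserving T P P) (hf : Measurable f)
    (N : ℕ) : Measurable (orbitAvg T f N) := by
  have h : ∀ i : ℕ, Measurable fun x => f (((T.toEquiv : Equiv.Perm X) ^ (i : ℤ)) x) := fun i =>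
    hf.comp (measurePreserving_perm_zpow hT (i : ℤ)).measurable
  exact (Finset.measurable_fun_sum _ fun i _ => h i).const_mul _

theorem lp_coeFn_finsetSum {ι : Type*} (s : Finset ι) (F : ι → Lp ℂ 2 P) :
    ((∑ i ∈ s, F i : Lp ℂ 2 P) : X → ℂ) =ᵐ[P] fun x => ∑ i ∈ s, F i x := by
  classical
  induction s using Finset.induction_on with
  | empty =>
    simp only [Finset.sum_empty]
    exact Lp.coeFn_zero ℂ 2 P
  | insert a s ha ih =>
    simp only [Finset.sum_insert ha]
    filter_upwards [Lp.coeFn_add (F a) (∑ i ∈ s, F i), ih] with x h1 h2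
    rw [h1, Pi.add_apply, h2]

/-- The mean ergodic theorem for a bounded function, in `L¹`. -/
theorem exists_invariant_limit_orbitAvg [IsProbabilityMeasure P] (hT : MeasurePreserving T P P)
    {f : X → ℂ} (hf : Measurable f) {B : ℝ} (hB : ∀ x, ‖f x‖ ≤ B) :
    ∃ g : X → ℂ, Integrable g P ∧ g ∘ T =ᵐ[P] g ∧
      Tendsto (fun N => eLpNorm (orbitAvg T f N - g) 1 P) atTop (𝓝 0) := by
  have hmem : MemLp f 2 P := MemLp.of_bound hf.aestronglyMeasurable B (Eventually.of_forall hB)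
  set U := Lp.compMeasurePreservingₗᵢ (E := ℂ) (p := 2) ℂ T hT with hU
  have hnorm : ‖U.toContinuousLinearMap‖ ≤ 1 := U.norm_toContinuousLinearMap_le
  -- Von Neumann's theorem for the Koopman isometry on `L²`; the limit is the projection onto the
  -- fixed vectors.
  have hlim := U.toContinuousLinearMap.tendsto_birkhoffAverage_orthogonalProjection hnorm
    (hmem.toLp f)
  set G := (U.toContinuousLinearMap.eqLocus
    (1 : Lp ℂ 2 P →L[ℂ] Lp ℂ 2 P)).orthogonalProjectionOnto (hmem.toLp f) with hG
  have hGinv : U (G : Lp ℂ 2 P) = (G : Lp ℂ 2 P) := G.2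
  have hiter : ∀ i : ℕ, (U.toContinuousLinearMap)^[i] (hmem.toLp f) =ᵐ[P]
      fun x => f (((T.toEquiv : Equiv.Perm X) ^ (i : ℤ)) x) := by
    intro i
    have e : ⇑U.toContinuousLinearMap = Lp.compMeasurePreserving T hT := rfl
    rw [e, Lp.compMeasurePreserving_iterate]
    refine (Lp.coeFn_compMeasurePreserving _ _).trans ?_
    have h1 : (T : X → X)^[i] = fun x => ((T.toEquiv : Equiv.Perm X) ^ (i : ℤ)) x := by
      rw [zpow_natCast, Equiv.Perm.coe_pow]
      rfl
    have h2 := (hT.iterate i).quasiMeasurePreserving.ae_eq_comp hmem.coeFn_toLp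
    refine h2.trans (Eventually.of_forall fun x => ?_)
    simp only [Function.comp_apply, h1]
  have havg : ∀ N, ((birkhoffAverage ℂ U.toContinuousLinearMap _root_.id N (hmem.toLp f) : Lp ℂ 2 P) : X → ℂ)
      =ᵐ[P] orbitAvg T f N := by
    intro N
    rw [birkhoffAverage, birkhoffSum]
    refine (Lp.coeFn_smul _ _).trans ?_
    have h2 := lp_coeFn_finsetSum (Finset.range N)
      fun i => (U.toContinuousLinearMap)^[i] (hmem.toLp f)
    have h3 : ∀ᵐ x ∂P, ∀ i : ℕ, ((U.toContinuousLinearMap)^[i] (hmem.toLp f) : Lp ℂ 2 P) x =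
        f (((T.toEquiv : Equiv.Perm X) ^ (i : ℤ)) x) := ae_all_iff.2 hiter
    filter_upwards [h2, h3] with x hx hx3
    simp only [Pi.smul_apply, id, orbitAvg, smul_eq_mul]
    rw [hx]
    simp only [hx3]
  refine ⟨G, (Lp.memLp (G : Lp ℂ 2 P)).integrable (by norm_num), ?_, ?_⟩
  · refine (Lp.coeFn_compMeasurePreserving (G : Lp ℂ 2 P) hT).symm.trans ?_
    have : Lp.compMeasurePreserving T hT (G : Lp ℂ 2 P) = G := hGinv
    rw [this]
  · rw [tendsto_iff_norm_sub_tendsto_zero] at hlim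
    have h4 : Tendsto (fun N => eLpNorm (orbitAvg T f N - ((G : Lp ℂ 2 P) : X → ℂ)) 2 P) atTop (𝓝 0) := by
      have h5 := (ENNReal.tendsto_ofReal hlim)
      rw [ENNReal.ofReal_zero] at h5
      refine h5.congr fun N => ?_
      rw [Lp.norm_def, ENNReal.ofReal_toReal (Lp.eLpNorm_ne_top _)]
      refine eLpNorm_congr_ae ((Lp.coeFn_sub _ _).trans ?_)
      exact (havg N).sub EventuallyEq.rfl
    -- On a probability space the `L¹` norm is at most the `L²` norm.
    refine tendsto_of_tendsto_of_tendsto_of_le_of_le tendsto_const_nhds h4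
      (fun _ => zero_le) fun N => ?_
    exact eLpNorm_le_eLpNorm_of_exponent_le (by norm_num)
      ((measurable_orbitAvg hT hf N).aestronglyMeasurable.sub (Lp.aestronglyMeasurable _))

end operator

/-! ### Dense class and Banach principle -/

section convergence

variable {X : Type*} [MeasurableSpace X] {μ : ℤ → ℝ} {P : Measure X} {T : X ≃ᵐ X}

theorem convPowOp_add {f g : X → ℂ} {n : ℕ} {x : X} (hf : Summable (convPowTerm μ T f n x))
    (hg : Summable (convPowTerm μ T g n x)) :
    convPowOp μ T (f + g) n x = convPowOp μ T f n x + convPowOp μ T g n x := by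
  rw [convPowOp, convPowOp, convPowOp, ← hf.tsum_add hg]
  refine tsum_congr fun k => ?_
  simp only [convPowTerm, Pi.add_apply]
  ring

/-- Functions whose orbits under the convolution powers converge are dense in `L¹`. -/
theorem exists_convergent_approximation [IsProbabilityMeasure P] (hμ : IsProbabilityOnInt μ)
    (hT : MeasurePreserving T P P)
    (hV : ∀ i : ℤ, Tendsto (fun n => ∑' x, |convPow μ n (x + i) - convPow μ n x|) atTop (𝓝 0))
    {f : X → ℂ} (hf : Integrable f P) {ε : ℝ≥0∞} (hε : ε ≠ 0) :
    ∃ h : X → ℂ, Integrable h P ∧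
      (∀ᵐ x ∂P, ∃ L : ℂ, Tendsto (fun n => convPowOp μ T h n x) atTop (𝓝 L)) ∧
      eLpNorm (f - h) 1 P ≤ ε := by
  have hε2 : ε / 2 ≠ 0 := by simpa using hε
  obtain ⟨ψ, hψ, -⟩ := (memLp_one_iff_integrable.2 hf).exists_simpleFunc_eLpNorm_sub_lt
    ENNReal.one_ne_top hε2
  obtain ⟨B, hB⟩ := ψ.exists_forall_norm_le
  obtain ⟨g, hg, hginv, hlim⟩ := exists_invariant_limit_orbitAvg hT ψ.measurable hB
  obtain ⟨N, hN1, hN0⟩ := ((hlim.eventually (gt_mem_nhds (pos_iff_ne_zero.2 hε2))).and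
    (eventually_ne_atTop 0)).exists
  have hψint : Integrable ψ P :=
    (MemLp.of_bound (p := 1) ψ.measurable.aestronglyMeasurable B
      (Eventually.of_forall hB)).integrable le_rfl
  have hAmeas : Measurable (orbitAvg T ψ N) := measurable_orbitAvg hT ψ.measurable N
  have hAB : ∀ x, ‖orbitAvg T ψ N x‖ ≤ B := by
    intro x
    have hN' : (0 : ℝ) < N := by exact_mod_cast Nat.pos_of_ne_zero hN0
    rw [orbitAvg, norm_mul, norm_inv, Complex.norm_natCast]
    have h1 : ‖∑ i ∈ Finset.range N, ψ (((T.toEquiv : Equiv.Perm X) ^ (i : ℤ)) x)‖ ≤ N * B := by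
      refine (norm_sum_le_of_le _ fun i _ => hB _).trans_eq ?_
      simp
    rw [inv_mul_le_iff₀ hN']
    exact h1
  have hAint : Integrable (orbitAvg T ψ N) P :=
    (MemLp.of_bound (p := 1) hAmeas.aestronglyMeasurable B
      (Eventually.of_forall hAB)).integrable le_rfl
  -- With `ψ` simple and near `f`, and `g` the invariant limit of the averages of `ψ`, the error is
  -- `(f - ψ) + (A_N ψ - g)`; each half is at most `ε/2`.
  refine ⟨g + fun y => ψ y - orbitAvg T ψ N y, hg.add (hψint.sub hAint), ?_, ?_⟩
  · filter_upwards [ae_convPowOp_eq_of_invariant hμ hT hginv, ae_summable_convPowTerm hμ hT hg]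
      with x h1 h2
    refine ⟨g x + 0, ?_⟩
    have h3 : ∀ n, convPowOp μ T (g + fun y => ψ y - orbitAvg T ψ N y) n x =
        g x + convPowOp μ T (fun y => ψ y - orbitAvg T ψ N y) n x := by
      intro n
      rw [convPowOp_add (h2 n), h1 n]
      refine summable_convPowTerm_of_bounded hμ (B := B + B) (fun y => ?_) n x
      exact (norm_sub_le _ _).trans (add_le_add (hB y) (hAB y))
    simp only [h3]
    exact (tendsto_convPowOp_sub_orbitAvg hμ hV hB hN0 x).const_add _
  · have e : f - (g + fun y => ψ y - orbitAvg T ψ N y) = (f - ψ) + (orbitAvg T ψ N - g) := by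
      funext y
      simp only [Pi.sub_apply, Pi.add_apply]
      ring
    rw [e]
    refine (eLpNorm_add_le (hf.sub hψint).aestronglyMeasurable
      (hAint.sub hg).aestronglyMeasurable le_rfl).trans ?_
    calc _ ≤ ε / 2 + ε / 2 := add_le_add hψ.le hN1.le
      _ = ε := ENNReal.add_halves ε

theorem enorm_convPowOp_le (hμ : IsProbabilityOnInt μ) (f : X → ℂ) (n : ℕ) (x : X) :
    ‖convPowOp μ T f n x‖ₑ ≤ ∑' k, ENNReal.ofReal (convPow μ n k) *
      ‖f (((T.toEquiv : Equiv.Perm X) ^ k) x)‖ₑ := by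
  have e : ∀ k, ENNReal.ofReal (convPow μ n k) * ‖f (((T.toEquiv : Equiv.Perm X) ^ k) x)‖ₑ =
      ‖convPowTerm μ T f n x k‖ₑ := by
    intro k
    rw [convPowTerm, enorm_mul, ← ofReal_norm (convPow μ n k : ℂ), Complex.norm_real,
      Real.norm_of_nonneg ((isProbabilityOnInt_convPow hμ n).1 k)]
  simp only [e]
  exact enorm_tsum_le_tsum_enorm

/-- The Banach principle for the convolution powers. -/
theorem ae_tendsto_convPowOp [IsProbabilityMeasure P] (hμ : IsProbabilityOnInt μ)
    (hT : MeasurePreserving T P P)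
    (hV : ∀ i : ℤ, Tendsto (fun n => ∑' x, |convPow μ n (x + i) - convPow μ n x|) atTop (𝓝 0))
    {C : ℝ≥0∞} (hC : C ≠ ∞)
    (hW : ∀ (l : ℝ≥0∞), l ≠ 0 → ∀ r : X → ℝ≥0∞, Measurable r →
      l * P {x | ∃ m : ℕ, 3 * l < ∑' k, ENNReal.ofReal (convPow μ (m + 2) k) *
        r (((T.toEquiv : Equiv.Perm X) ^ k) x)} ≤ C * ∫⁻ x, r x ∂P)
    {f : X → ℂ} (hf : Integrable f P) :
    ∀ᵐ x ∂P, ∃ L : ℂ, Tendsto (fun n => convPowOp μ T f n x) atTop (𝓝 L) := by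
  have hSmp := measurePreserving_perm_zpow hT
  -- The constant is `7 = 1 + 3 + 3`: the convergent part oscillates by less than `l`, and each of
  -- the two remainder values is at most `3l`.
  have hosc : ∀ l : ℝ, 0 < l → ∀ᵐ x ∂P, ∃ N, ∀ n ≥ N, ∀ m ≥ N,
      dist (convPowOp μ T f n x) (convPowOp μ T f m x) ≤ 7 * l := by
    intro l hl
    set l' : ℝ≥0∞ := ENNReal.ofReal l with hl'
    have hl0 : l' ≠ 0 := by simpa [l'] using hl
    have hltop : l' ≠ ∞ := ENNReal.ofReal_ne_top
    rw [ae_iff]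
    set E : Set X := {x | ¬∃ N, ∀ n ≥ N, ∀ m ≥ N,
      dist (convPowOp μ T f n x) (convPowOp μ T f m x) ≤ 7 * l} with hE
    have hkey : ∀ ε : ℝ≥0∞, ε ≠ 0 → l' * P E ≤ C * ε := by
      intro ε hε
      obtain ⟨h, hh, hconv, hsmall⟩ := exists_convergent_approximation hμ hT hV hf hε
      have hr : Integrable (f - h) P := hf.sub hh
      have hrm : AEMeasurable (fun x => ‖(f - h) x‖ₑ) P := hr.aestronglyMeasurable.enorm
      -- The maximal inequality is stated for measurable functions; a measurable representative
      -- agrees along the whole countable orbit for almost every `x`.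
      have hall : ∀ᵐ x ∂P, ∀ k : ℤ, ‖(f - h) (((T.toEquiv : Equiv.Perm X) ^ k) x)‖ₑ =
          hrm.mk _ (((T.toEquiv : Equiv.Perm X) ^ k) x) := by
        rw [ae_all_iff]
        intro k
        exact (hSmp k).quasiMeasurePreserving.ae hrm.ae_eq_mk
      have hsub : E ≤ᵐ[P] {x | ∃ m : ℕ, 3 * l' < ∑' k, ENNReal.ofReal (convPow μ (m + 2) k) *
          hrm.mk _ (((T.toEquiv : Equiv.Perm X) ^ k) x)} := by
        filter_upwards [hall, hconv, ae_summable_convPowTerm hμ hT hh,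
          ae_summable_convPowTerm hμ hT hr] with x h1 h2 h3 h4 hxE
        by_contra hcon
        have hcon' : ∀ m : ℕ, ∑' k, ENNReal.ofReal (convPow μ (m + 2) k) *
            hrm.mk _ (((T.toEquiv : Equiv.Perm X) ^ k) x) ≤ 3 * l' := fun m =>
          not_lt.1 fun hlt => hcon ⟨m, hlt⟩
        have hrn : ∀ n ≥ 2, ‖convPowOp μ T (f - h) n x‖ ≤ 3 * l := by
          intro n hn
          obtain ⟨m, rfl⟩ := Nat.exists_eq_add_of_le' hn
          have h5 := (enorm_convPowOp_le (T := T) hμ (f - h) (m + 2) x)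
          simp only [h1] at h5
          have h6 := h5.trans (hcon' m)
          have h7 : 3 * l' = ENNReal.ofReal (3 * l) := by
            rw [ENNReal.ofReal_mul (by norm_num)]
            simp [l']
          rw [h7, ← ofReal_norm, ENNReal.ofReal_le_ofReal_iff (by positivity)] at h6
          exact h6
        obtain ⟨L, hL⟩ := h2
        obtain ⟨N, hN⟩ := Metric.cauchySeq_iff.1 hL.cauchySeq l hl
        -- The maximal inequality only controls powers `n ≥ 2`.
        refine hxE ⟨max N 2, fun n hn m hm => ?_⟩
        have e : ∀ n, convPowOp μ T f n x = convPowOp μ T h n x + convPowOp μ T (f - h) n x := by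
          intro n
          rw [← convPowOp_add (h3 n) (h4 n), add_sub_cancel]
        have d1 := hN n ((le_max_left _ _).trans hn) m ((le_max_left _ _).trans hm)
        have d2 := hrn n ((le_max_right _ _).trans hn)
        have d3 := hrn m ((le_max_right _ _).trans hm)
        rw [dist_eq_norm] at d1 ⊢
        rw [e n, e m, add_sub_add_comm]
        have d4 := norm_sub_le (convPowOp μ T (f - h) n x) (convPowOp μ T (f - h) m x)
        refine (norm_add_le _ _).trans ?_
        linarith
      calc l' * P E ≤ l' * P {x | ∃ m : ℕ, 3 * l' < ∑' k, ENNReal.ofReal (convPow μ (m + 2) k) *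
            hrm.mk _ (((T.toEquiv : Equiv.Perm X) ^ k) x)} := by
            gcongr 1
            exact measure_mono_ae hsub
        _ ≤ C * ∫⁻ x, hrm.mk _ x ∂P := hW l' hl0 _ hrm.measurable_mk
        _ ≤ C * ε := by
            gcongr 1
            rw [← lintegral_congr_ae hrm.ae_eq_mk, ← eLpNorm_one_eq_lintegral_enorm]
            exact hsmall
    have hzero : l' * P E = 0 := by
      have h1 : Tendsto (fun n : ℕ => C * (n : ℝ≥0∞)⁻¹) atTop (𝓝 (C * 0)) :=
        ENNReal.Tendsto.const_mul ENNReal.tendsto_inv_nat_nhds_zero (Or.inr hC)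
      rw [mul_zero] at h1
      exact le_antisymm (ge_of_tendsto' h1 fun n => hkey _ (by simp)) zero_le
    exact (mul_eq_zero.1 hzero).resolve_left hl0
  have hall : ∀ᵐ x ∂P, ∀ j : ℕ, ∃ N, ∀ n ≥ N, ∀ m ≥ N,
      dist (convPowOp μ T f n x) (convPowOp μ T f m x) ≤ 7 * (1 / ((j : ℝ) + 1)) :=
    ae_all_iff.2 fun j => hosc _ (by positivity)
  filter_upwards [hall] with x hx
  refine cauchySeq_tendsto_of_complete (Metric.cauchySeq_iff.2 fun ε hε => ?_)
  obtain ⟨j, hj⟩ := exists_nat_one_div_lt (show 0 < ε / 7 by positivity)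
  obtain ⟨N, hN⟩ := hx j
  refine ⟨N, fun m hm n hn => (hN m hm n hn).trans_lt ?_⟩
  linarith

end convergence

/-! ### Bounded angular ratio -/

section angular

variable {μ : ℤ → ℝ}

theorem angularRatio_eq (hμ : IsProbabilityOnInt μ) (hs : IsSymmetricOnInt μ) (t : ℝ) :
    angularRatio μ t = (1 - cosTransform μ t) / (1 - |cosTransform μ t|) := by
  rw [angularRatio, fourierInt_eq_cosTransform hμ hs, ← Complex.ofReal_one, ← Complex.ofReal_sub,
    Complex.norm_real, Complex.norm_real, Real.norm_eq_abs, Real.norm_eq_abs, abs_sub_comm,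
    abs_of_nonneg]
  linarith [(abs_le.1 (abs_cosTransform_le_one hμ t)).2]

theorem ne_intCast_of_mem_Ico {t : ℝ} (ht : t ∈ Set.Ico (-1 / 2 : ℝ) (1 / 2)) (h0 : t ≠ 0)
    (m : ℤ) : t ≠ m := by
  rintro rfl
  have e1 : (-1 : ℝ) < m := by linarith [ht.1]
  have e2 : (m : ℝ) < 1 := by linarith [ht.2]
  have e3 : -1 < m := by exact_mod_cast e1
  have e4 : m < 1 := by exact_mod_cast e2
  exact h0 (by exact_mod_cast (show m = 0 by omega))

/-- Continuity gives `θ > 0` near `0`, so numerator and denominator coincide; strict aperiodicity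
keeps them nonzero. -/
theorem exists_angularRatio_eq_one (hμ : IsProbabilityOnInt μ) (hs : IsSymmetricOnInt μ)
    (hap : StrictlyAperiodic μ) :
    ∃ r > 0, ∀ t, |t| < r → t ≠ 0 → angularRatio μ t = 1 := by
  have h1 : ∀ᶠ t in 𝓝 (0 : ℝ), 0 < cosTransform μ t :=
    (continuous_cosTransform hμ).continuousAt.eventually
      (lt_mem_nhds (by rw [cosTransform_zero hμ]; exact one_pos))
  obtain ⟨r, hr, h⟩ := Metric.eventually_nhds_iff.1 h1
  refine ⟨min r (1 / 2), by positivity, fun t ht h0 => ?_⟩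
  have hpos := h (show dist t 0 < r by simpa using ht.trans_le (min_le_left _ _))
  have ht2 := abs_lt.1 (ht.trans_le (min_le_right _ _))
  have hlt := abs_cosTransform_lt_one hμ hap
    (ne_intCast_of_mem_Ico ⟨by linarith [ht2.1], ht2.2⟩ h0)
  rw [angularRatio_eq hμ hs, abs_of_pos hpos]
  rw [abs_of_pos hpos] at hlt
  exact div_self (by linarith)

/-- Near `0` the ratio is `1`; elsewhere the numerator is at most `2` and the denominator at least
`1 - ρ`. The lower bound `1` is `θ ≤ |θ|`. -/
theorem boundedAngularRatio_of_symmetric (hμ : IsProbabilityOnInt μ) (hs : IsSymmetricOnInt μ)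
    (hap : StrictlyAperiodic μ) : BoundedAngularRatio μ := by
  obtain ⟨r, hr, h⟩ := exists_angularRatio_eq_one hμ hs hap
  obtain ⟨ρ, hρ0, hρ1, hρ⟩ := exists_abs_cosTransform_le hμ hap hr
  set A := angularRatio μ '' {t | t ∈ Set.Ico (-1 / 2 : ℝ) (1 / 2) ∧ t ≠ 0} with hA
  have hne : A.Nonempty := ⟨_, 1 / 4, ⟨⟨by norm_num, by norm_num⟩, by norm_num⟩, rfl⟩
  have hge : ∀ a ∈ A, 1 ≤ a := by
    rintro _ ⟨t, ⟨ht, h0⟩, rfl⟩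
    have hlt := abs_cosTransform_lt_one hμ hap (ne_intCast_of_mem_Ico ht h0)
    rw [angularRatio_eq hμ hs, le_div_iff₀ (by linarith)]
    linarith [le_abs_self (cosTransform μ t)]
  have hbdd : BddAbove A := by
    refine ⟨max 1 (2 / (1 - ρ)), ?_⟩
    rintro _ ⟨t, ⟨ht, h0⟩, rfl⟩
    rcases lt_or_ge |t| r with htr | htr
    · rw [h t htr h0]
      exact le_max_left _ _
    · refine le_trans ?_ (le_max_right _ _)
      have h1 := hρ t (Set.Ico_subset_Icc_self ht) htr
      rw [angularRatio_eq hμ hs]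
      have h2 := (abs_le.1 (abs_cosTransform_le_one hμ t)).1
      exact div_le_div₀ (by norm_num) (by linarith) (by linarith) (by linarith)
  obtain ⟨a, ha⟩ := hne
  exact ⟨hap, sSup A, (hge a ha).trans (le_csSup hbdd ha), isLUB_csSup ⟨a, ha⟩ hbdd⟩

end angular

/-! ### Assembly -/

theorem corollary2p2
    (μ : ℤ → ℝ) (hμ : IsProbabilityOnInt μ)
    (hsymm : IsSymmetricOnInt μ) (haper : StrictlyAperiodic μ)
    (α : ℝ) (hα0 : 0 < α) (hα1 : α ≤ 1)
    (hmoment : (fun n : ℕ => ∑ k ∈ Finset.Icc (-(n : ℤ)) (n : ℤ), (k : ℝ) ^ 2 * μ k)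
      =O[atTop] (fun n : ℕ => (n : ℝ) ^ (1 - α)))
    (δ : ℝ) (hδ : 0 < δ)
    -- `θ''` exists on `0 < |t| < δ` and is negative there (`θ` is real-valued by symmetry)
    (hdiff : ∀ t : ℝ, 0 < |t| → |t| < δ →
      DifferentiableAt ℝ (fourierInt μ) t ∧ DifferentiableAt ℝ (deriv (fourierInt μ)) t)
    (hneg : ∀ t : ℝ, 0 < |t| → |t| < δ → (deriv (deriv (fourierInt μ)) t).re < 0)
    -- `θ'' = p + O(1)` with `p` non-decreasing to the right of `0`
    (p : ℝ → ℝ) (hp : MonotoneOn p (Set.Ioo 0 δ))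
    (hO : (fun t : ℝ => deriv (deriv (fourierInt μ)) t - (p t : ℂ))
      =O[𝓝[≠] 0] (fun _ : ℝ => (1 : ℝ))) :
    (BoundedAngularRatio μ ∧ ∀ᶠ t in 𝓝[≠] (0 : ℝ), angularRatio μ t = 1) ∧
    ∀ (X : Type*) [MeasurableSpace X] (P : Measure X) [IsProbabilityMeasure P]
      (T : X ≃ᵐ X), MeasurePreserving T P P →
      ∀ f : X → ℂ, Integrable f P →
        ∀ᵐ x ∂P, (∀ n : ℕ, Summable (convPowTerm μ T f n x)) ∧
          ∃ L : ℂ, Tendsto (fun n : ℕ => convPowOp μ T f n x) atTop (𝓝 L) := by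
  refine ⟨⟨boundedAngularRatio_of_symmetric hμ hsymm haper, ?_⟩, ?_⟩
  · obtain ⟨r, hr, h⟩ := exists_angularRatio_eq_one hμ hsymm haper
    refine eventually_nhdsWithin_iff.2 (Metric.eventually_nhds_iff.2 ⟨r, hr, fun t ht h0 => ?_⟩)
    exact h t (by simpa using ht) h0
  intro X _ P _ T hT f hf
  have hmom := summable_abs_mul_of_truncated_second_moment hμ.1 hα0 hmoment
  obtain ⟨Φ, C, hΦ0, hΦ, hK⟩ :=
    exists_hormander_majorant hμ hsymm haper hmom hδ hdiff hneg hp hO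
  have hV := tendsto_tsum_abs_convPow_sub hμ (tendsto_convPow_zero hμ hsymm haper) hΦ0
    (fun h => (hΦ h).1) hK
  have hprob := isProbabilityOnInt_convPow hμ
  have hweak := fun (l : ENNReal) (hl : l ≠ 0) (F : ℤ → ENNReal) =>
    weak_type_of_hormander (K := fun (m : ℕ) k => ENNReal.ofReal (convPow μ (m + 2) k))
      (Φ := fun h x => ENNReal.ofReal (Φ h x)) (C := ENNReal.ofReal C)
      (fun m => by
        rw [← ENNReal.ofReal_tsum_of_nonneg (hprob (m + 2)).1 (hprob (m + 2)).2.summable,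
          (hprob (m + 2)).2.tsum_eq, ENNReal.ofReal_one])
      (fun h => by
        rw [← ENNReal.ofReal_tsum_of_nonneg (hΦ0 h) (hΦ h).1]
        exact ENNReal.ofReal_le_ofReal (hΦ h).2)
      (fun m h x hx => by
        rw [← ENNReal.ofReal_add ((hprob (m + 2)).1 x) (hΦ0 h x)]
        refine ENNReal.ofReal_le_ofReal ?_
        linarith [(abs_le.1 (hK m h x hx)).2])
      F hl
  have hconv := ae_tendsto_convPowOp hμ hT hV (C := 7 + ENNReal.ofReal C) (by finiteness)
    (fun l hl r hr => weak_type_transference (hweak l hl) hT hr) hf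
  filter_upwards [ae_summable_convPowTerm hμ hT hf, hconv] with x h1 h2
  exact ⟨h1, h2⟩
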